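/- Let $\Bbbk$ be an algebraically closed field and let $A$ be a finite-dimensional (unital, associative) $\Bbbk$-algebra of finite global dimension. Let $A\text{-mod}$ be the category of finite-dimensional left $A$-modules and $\mathcal{D}^b(A)$ its bounded derived category; write $(-)^*=\operatorname{Hom}_{\Bbbk}(-,\Bbbk)$. Let $\mathcal{PI}$ be the full subcategory of $A\text{-mod}$ consisting of the modules which are both projective and injective, and let $H=A^*\otimes_A-:A\text{-mod}\to A\text{-mod}$ be the Nakayama functor. Let $Q$ be the basic projective-injective $A$-module, i.e. the direct sum of a complete system of representatives of the isomorphism classes of indecomposable projective-injective modules, each taken once. Assume that $Q$ is good, i.e. the socle of $Q$ is isomorphic to its head. Assume also that both $A$ and $A^{\mathrm{opp}}$ have the double centraliser property with respect to some projective-injective module; here an algebra $B$ has this property with respect to a module $X\in B\text{-mod}$ if the canonical map $B\to\operatorname{End}_{\operatorname{End}_B(X)}(X)$ is an isomorphism. Let $F:A\text{-mod}\to A\text{-mod}$ be a right exact (additive) functor. Then $F$ has a left derived functor $\mathcal{L}F:\mathcal{D}^b(A)\to\mathcal{D}^b(A)$, and $\mathcal{L}F$ is a Serre functor of $\mathcal{D}^b(A)$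 (that is, an additive auto-equivalence for which there are isomorphisms of $\Bbbk$-vector spaces $\operatorname{Hom}(X,\mathcal{L}F\,Y)\cong\operatorname{Hom}(Y,X)^*$, natural in $X$ and $Y$) if and only if the following three conditions hold: (a) $\mathcal{L}F:\mathcal{D}^b(A)\to\mathcal{D}^b(A)$ is an auto-equivalence; (b) $F$ maps projective $A$-modules to injective $A$-modules; (c) $F$ preserves $\mathcal{PI}$, and the restrictions of $F$ and $H$ to $\mathcal{PI}$ are isomorphic functors. -/

import Mathlib

open CategoryTheory Limits
open scoped TensorProduct ModuleCat

universe u w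

noncomputable section

/-! ### The bounded homotopy category and left derived functors on bounded derived categories -/

section Derived

variable (C : Type*) [Category C] [Abelian C]

/-- The objects of the homotopy category of cochain complexes which are bounded complexes. -/
def boundedHomotopyObjects : ObjectProperty (HomotopyCategory C (ComplexShape.up ℤ)) :=
  fun K => ∃ a b : ℤ, CochainComplex.IsStrictlyGE K.as a ∧ CochainComplex.IsStrictlyLE K.as b

/-- The homotopy category `K^b(C)` of bounded cochain complexes. -/
abbrev BoundedHomotopy := (boundedHomotopyObjects C).FullSubcategory

/-- The canonical functor `K^b(C) ⥤ D^b(C)`. -/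
def boundedQh [HasDerivedCategory C] : BoundedHomotopy C ⥤ DerivedCategory.Bounded C :=
  (DerivedCategory.TStructure.t (C := C)).bounded.lift
    ((boundedHomotopyObjects C).ι ⋙ DerivedCategory.Qh) (by
      rintro ⟨K, a, b, ha, hb⟩
      obtain ⟨K, rfl⟩ := HomotopyCategory.quotient_obj_surjective K
      have e := (DerivedCategory.quotientCompQhIso C).app K
      exact ⟨⟨a, ⟨K, e, ha⟩⟩, ⟨b, ⟨K, e, hb⟩⟩⟩)

variable {C}

/-- The functor `K^b(C) ⥤ K^b(C)` obtained by applying an additive functor `F : C ⥤ C`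
to complexes term by term. -/
def mapBoundedHomotopy (F : C ⥤ C) [F.Additive] : BoundedHomotopy C ⥤ BoundedHomotopy C :=
  (boundedHomotopyObjects C).lift
    ((boundedHomotopyObjects C).ι ⋙ F.mapHomotopyCategory (ComplexShape.up ℤ)) (by
      rintro ⟨K, a, b, ha, hb⟩
      obtain ⟨K, rfl⟩ := HomotopyCategory.quotient_obj_surjective K
      have ha' : CochainComplex.IsStrictlyGE K a := ha
      have hb' : CochainComplex.IsStrictlyLE K b := hb
      exact ⟨a, b,
        inferInstanceAs (CochainComplex.IsStrictlyGE ((F.mapHomologicalComplex _).obj K) a),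
        inferInstanceAs (CochainComplex.IsStrictlyLE ((F.mapHomologicalComplex _).obj K) b)⟩)

/-- `LF : D^b(C) ⥤ D^b(C)` is a (total) left derived functor of the additive functor `F : C ⥤ C`:
there is a natural transformation from `K^b(C) ⥤ D^b(C)` followed by `LF` to `F` (applied term by
term) followed by `K^b(C) ⥤ D^b(C)` which is terminal among such, that is, `LF` is the right Kan
extension along `K^b(C) ⥤ D^b(C)`. It determines `LF` up to a natural isomorphism. -/
def IsBoundedLeftDerived [HasDerivedCategory C] (F : C ⥤ C) [F.Additive]
    (LF : DerivedCategory.Bounded C ⥤ DerivedCategory.Bounded C) : Prop :=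
  ∃ α : boundedQh C ⋙ LF ⟶ mapBoundedHomotopy F ⋙ boundedQh C, LF.IsRightKanExtension α

end Derived

/-! ### Serre functors -/

section Serre

variable (k : Type*) [Field k] {C : Type*} [Category C] [Preadditive C] [Linear k C]

/-- Natural isomorphisms `Hom(X, S Y) ≅ Hom(Y, X)^*` of `k`-vector spaces. -/
structure SerreDuality (S : C ⥤ C) where
  /-- the isomorphism for a pair of objects -/
  iso (X Y : C) : (X ⟶ S.obj Y) ≃ₗ[k] Module.Dual k (Y ⟶ X)
  naturality_left {X X' Y : C} (f : X' ⟶ X) (h : X ⟶ S.obj Y) (t : Y ⟶ X') :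
    iso X' Y (f ≫ h) t = iso X Y h (t ≫ f)
  naturality_right {X Y Y' : C} (g : Y ⟶ Y') (h : X ⟶ S.obj Y) (t : Y' ⟶ X) :
    iso X Y' (h ≫ S.map g) t = iso X Y h (g ≫ t)

/-- A Serre functor: an additive auto-equivalence `S` of `C` for which there are isomorphisms
`Hom(X, S Y) ≅ Hom(Y, X)^*`, natural in `X` and `Y`. -/
def IsSerreFunctor (S : C ⥤ C) : Prop :=
  S.Additive ∧ Nonempty (SerreDuality k S) ∧ S.IsEquivalence

end Serre

/-! ### The Nakayama functor `A^* ⊗_A -` -/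

section Nakayama

variable (k A : Type u) [Field k] [Ring A] [Algebra k A]

/-- The `k`-dual `A^*` of the algebra `A`. It is an `A`-bimodule; the left action is
`(a • φ) x = φ (x * a)` and the right action is `(φ • a) x = φ (a * x)`. -/
def AlgebraDual : Type u := A →ₗ[k] k

namespace AlgebraDual

instance : AddCommGroup (AlgebraDual k A) := inferInstanceAs (AddCommGroup (A →ₗ[k] k))

instance : Module k (AlgebraDual k A) := inferInstanceAs (Module k (A →ₗ[k] k))

instance [Module.Finite k A] : Module.Finite k (AlgebraDual k A) :=
  inferInstanceAs (Module.Finite k (Module.Dual k A))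

variable {k A}

instance : FunLike (AlgebraDual k A) A k := inferInstanceAs (FunLike (A →ₗ[k] k) A k)

@[ext] theorem ext {φ ψ : AlgebraDual k A} (h : ∀ x, φ x = ψ x) : φ = ψ := LinearMap.ext h

/-- The right action of `A` on `A^*`. -/
def rightMul (φ : AlgebraDual k A) (a : A) : AlgebraDual k A :=
  LinearMap.comp (show A →ₗ[k] k from φ) (LinearMap.mulLeft k a)

/-- The left action of `A` on `A^*`. -/
instance : SMul A (AlgebraDual k A) where
  smul a φ := LinearMap.comp (show A →ₗ[k] k from φ) (LinearMap.mulRight k a)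

theorem rightMul_apply (φ : AlgebraDual k A) (a x : A) : φ.rightMul a x = φ (a * x) := rfl

theorem smul_apply (a : A) (φ : AlgebraDual k A) (x : A) : (a • φ) x = φ (x * a) := rfl

theorem add_apply (φ ψ : AlgebraDual k A) (x : A) : (φ + ψ) x = φ x + ψ x := rfl

theorem zero_apply (x : A) : (0 : AlgebraDual k A) x = 0 := rfl

theorem field_smul_apply (c : k) (φ : AlgebraDual k A) (x : A) :
    (show AlgebraDual k A from c • φ) x = c * φ x := rfl

theorem apply_add (φ : AlgebraDual k A) (x y : A) : φ (x + y) = φ x + φ y :=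
  LinearMap.map_add (show A →ₗ[k] k from φ) x y

theorem apply_zero (φ : AlgebraDual k A) : φ 0 = 0 :=
  LinearMap.map_zero (show A →ₗ[k] k from φ)

theorem apply_smul (φ : AlgebraDual k A) (c : k) (x : A) : φ (c • x) = c * φ x :=
  LinearMap.map_smul (show A →ₗ[k] k from φ) c x

instance : Module A (AlgebraDual k A) where
  one_smul φ := by ext x; simp [smul_apply]
  mul_smul a b φ := by ext x; simp [smul_apply, mul_assoc]
  smul_zero a := by ext x; simp [smul_apply, zero_apply]
  smul_add a φ ψ := by ext x; simp [smul_apply, add_apply]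
  add_smul a b φ := by ext x; simp [smul_apply, add_apply, mul_add, apply_add]
  zero_smul φ := by ext x; simp [smul_apply, zero_apply, apply_zero]

instance : IsScalarTower k A (AlgebraDual k A) where
  smul_assoc c a φ := by
    ext x
    rw [smul_apply, field_smul_apply, smul_apply, mul_smul_comm, apply_smul]

instance : SMulCommClass k A (AlgebraDual k A) where
  smul_comm c a φ := by
    ext x
    rw [field_smul_apply, smul_apply, smul_apply, field_smul_apply]

instance : SMulCommClass A k (AlgebraDual k A) := SMulCommClass.symm _ _ _

end AlgebraDual

section Modules

variable (M : Type u) [AddCommGroup M] [Module k M] [Module A M] [IsScalarTower k A M]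

/-- The relations `φ a ⊗ m = φ ⊗ a m` which define `A^* ⊗_A M` as a quotient of `A^* ⊗_k M`. -/
def nakayamaRelations : Submodule A (AlgebraDual k A ⊗[k] M) :=
  Submodule.span A
    {t | ∃ (φ : AlgebraDual k A) (a : A) (m : M), t = φ.rightMul a ⊗ₜ[k] m - φ ⊗ₜ[k] (a • m)}

/-- The left `A`-module `A^* ⊗_A M`. -/
abbrev NakayamaModule : Type u := (AlgebraDual k A ⊗[k] M) ⧸ nakayamaRelations k A M

variable {M} {N : Type u} [AddCommGroup N] [Module k N] [Module A N] [IsScalarTower k A N]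

/-- The map `id ⊗ f : A^* ⊗_A M → A^* ⊗_A N`. -/
def nakayamaMap (f : M →ₗ[A] N) : NakayamaModule k A M →ₗ[A] NakayamaModule k A N :=
  Submodule.mapQ _ _
    (TensorProduct.AlgebraTensorModule.map (LinearMap.id : AlgebraDual k A →ₗ[A] AlgebraDual k A)
      (f.restrictScalars k)) (by
    refine Submodule.span_le.2 ?_
    rintro _ ⟨φ, a, m, rfl⟩
    refine Submodule.subset_span ⟨φ, a, f m, ?_⟩
    simp)

theorem nakayamaMap_mk_tmul (f : M →ₗ[A] N) (φ : AlgebraDual k A) (m : M) :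
    nakayamaMap k A f ((nakayamaRelations k A M).mkQ (φ ⊗ₜ[k] m)) =
      (nakayamaRelations k A N).mkQ (φ ⊗ₜ[k] f m) := rfl

theorem nakayamaMap_id : nakayamaMap k A (LinearMap.id : M →ₗ[A] M) = LinearMap.id := by
  refine LinearMap.ext fun x => ?_
  obtain ⟨x, rfl⟩ := Submodule.mkQ_surjective _ x
  induction x using TensorProduct.induction_on with
  | zero => simp only [map_zero]
  | tmul φ m => rfl
  | add x y hx hy => simp only [map_add, hx, hy]

theorem nakayamaMap_comp {L : Type u} [AddCommGroup L] [Module k L] [Module A L]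
    [IsScalarTower k A L] (f : L →ₗ[A] M) (g : M →ₗ[A] N) :
    nakayamaMap k A (g.comp f) = (nakayamaMap k A g).comp (nakayamaMap k A f) := by
  refine LinearMap.ext fun x => ?_
  obtain ⟨x, rfl⟩ := Submodule.mkQ_surjective _ x
  induction x using TensorProduct.induction_on with
  | zero => simp only [map_zero]
  | tmul φ m => rfl
  | add x y hx hy => simp only [map_add, hx, hy]

end Modules

/-- The Nakayama functor `H = A^* ⊗_A -` on finite-dimensional left `A`-modules. -/
def nakayamaFunctor [Module.Finite k A] : FGModuleCat.{u} A ⥤ FGModuleCat.{u} A where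
  obj M :=
    haveI : Module.Finite k M.obj := Module.Finite.trans A M.obj
    haveI : Module.Finite A (NakayamaModule k A M.obj) :=
      Module.Finite.of_restrictScalars_finite k A _
    FGModuleCat.of A (NakayamaModule k A M.obj)
  map f := ObjectProperty.homMk (ModuleCat.ofHom (nakayamaMap k A f.hom.hom))
  map_id M := by
    apply ObjectProperty.hom_ext
    apply ModuleCat.hom_ext
    exact nakayamaMap_id k A
  map_comp f g := by
    apply ObjectProperty.hom_ext
    apply ModuleCat.hom_ext
    exact nakayamaMap_comp k A f.hom.hom g.hom.hom

end Nakayama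

/-! ### Projective-injective modules and double centralisers -/

section Modules

variable (A : Type u) [Ring A]

/-- The full subcategory of `A`-mod of modules which are both projective and injective. -/
def projInj : ObjectProperty (FGModuleCat.{u} A) := fun M => Projective M ∧ Injective M

/-- `A` has the double centraliser property with respect to `X`: the canonical map
`A → End_{End_A(X)}(X)` is an isomorphism. -/
def HasDoubleCentraliser (X : Type u) [AddCommGroup X] [Module A X] : Prop :=
  Function.Bijective (Module.toModuleEnd (Module.End A X) (S := A) X)

/-- The socle of a module, the sum of its simple submodules. -/
def moduleSocle (M : Type u) [AddCommGroup M] [Module A M] : Submodule A M :=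
  sSup {N : Submodule A M | IsSimpleModule A N}

/-- The head (top) of a module, the quotient by its radical. -/
abbrev ModuleHead (M : Type u) [AddCommGroup M] [Module A M] : Type u := M ⧸ Module.jacobson A M

/-- A (projective-injective) module is good if its socle is isomorphic to its head. -/
def IsGoodModule (M : Type u) [AddCommGroup M] [Module A M] : Prop :=
  Nonempty (moduleSocle A M ≃ₗ[A] ModuleHead A M)

/-- `Q` is a basic projective-injective module: the direct sum of a complete system of
representatives of the isomorphism classes of indecomposable projective-injective modules, each
taken once. -/
def IsBasicProjInj [IsNoetherianRing A] (Q : FGModuleCat.{u} A) : Prop :=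
  ∃ (n : ℕ) (P : Fin n → FGModuleCat.{u} A),
    (∀ i, Indecomposable (P i) ∧ projInj A (P i)) ∧
    (∀ i j, Nonempty (P i ≅ P j) → i = j) ∧
    (∀ M, Indecomposable M → projInj A M → ∃ i, Nonempty (M ≅ P i)) ∧
    Nonempty (Q ≃ₗ[A] ∀ i, P i)

/-- `A` has finite global dimension: the projective dimensions of the finitely generated left
`A`-modules are bounded. -/
def HasFiniteGlobalDimension [IsNoetherianRing A] : Prop :=
  ∃ n : ℕ, ∀ M : FGModuleCat.{u} A, HasProjectiveDimensionLE M n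

end Modules

end

noncomputable section

/-! ### Bounded complexes of projective objects -/

section BoundedProjectiveResolutions

open Pretriangulated DerivedCategory ZeroObject

variable {C : Type*} [Category C] [Abelian C]

/-! Serre duality on `D^b(A)` is reduced to a statement about projective modules. Finite global
dimension lets every object of `D^b(A)` be represented by a bounded complex of projectives, so `LF`
is computed by applying `F` termwise to such a complex
(`isBoundedLeftDerived_projectiveResolutionFunctor`). On projectives the Nakayama functor `H`
carries a trace `Hom(P, HP) → k`, built from a dual basis of `P`, that is cyclic and induces `Hom(M,
HP) ≅ Hom(P, M)^*` (`nakayamaTrace`). An alternating sum of traces extends any such trace to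
complexes and then to `D^b(A)` (`IsBoundedLeftDerived.nonempty_serreTrace`). So an isomorphism `F ≅
H` on projectives makes `LF` satisfy Serre duality.

If `LF` is a Serre functor, then it is isomorphic to the derived functor of `H`, because a functor
with a Serre trace is unique; restriction to degree `0` gives `F ≅ H` on projectives. Then (b) holds
since `Hom(-, HP) ≅ Hom(P, -)^*` sends monomorphisms to surjections. Condition (c) needs `H` to
preserve projective-injectives: the simples in the socle of `HP` are those in the head of `P`, hence
occur in the head of `Q`, hence in its socle as `Q` is good, so the injective module `HP` is a
summand of a power of `Q` (`projInj_nakayamaFunctor_obj`).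

Conversely, given (a)-(c), `F` is fully faithful on projectives because `LF` is an equivalence, and
`H` is so by its trace. Both send projectives to injectives and agree on `Q` together with its
endomorphisms. Dualising the double centraliser property of the opposite algebra gives a
projective-injective `V` for which `Hom(V, -)` is fully faithful on injectives (`exists_isDenseOn`);
by goodness `V` is a summand of a power of `HQ`. Hence injectives are controlled by maps from `HQ`,
and the agreement at `Q` spreads to all projectives (`nonempty_iso_of_isDenseOn`). -/

/-- A bounded cochain complex all of whose terms are projective. -/
structure IsBoundedProjectiveComplex (K : CochainComplex C ℤ) : Prop where
  bounded : ∃ a b : ℤ, K.IsStrictlyGE a ∧ K.IsStrictlyLE b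
  projective : ∀ n, Projective (K.X n)

theorem IsBoundedProjectiveComplex.isKProjective {K : CochainComplex C ℤ}
    (hK : IsBoundedProjectiveComplex K) : K.IsKProjective := by
  obtain ⟨a, b, _, _⟩ := hK.bounded
  have := hK.projective
  exact CochainComplex.isKProjective_of_projective K b

theorem IsBoundedProjectiveComplex.shift {K : CochainComplex C ℤ}
    (hK : IsBoundedProjectiveComplex K) (n : ℤ) : IsBoundedProjectiveComplex (K⟦n⟧) := by
  obtain ⟨a, b, _, _⟩ := hK.bounded
  exact ⟨⟨a - n, b - n, K.isStrictlyGE_shift a n (a - n) (by lia),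
    K.isStrictlyLE_shift b n (b - n) (by lia)⟩, fun i => hK.projective _⟩

theorem IsBoundedProjectiveComplex.mappingCone {K L : CochainComplex C ℤ}
    (hK : IsBoundedProjectiveComplex K) (hL : IsBoundedProjectiveComplex L) (f : K ⟶ L) :
    IsBoundedProjectiveComplex (CochainComplex.mappingCone f) := by
  obtain ⟨a, b, _, _⟩ := hK.bounded
  obtain ⟨a', b', _, _⟩ := hL.bounded
  refine ⟨⟨min (a - 1) a', max b b', ?_, ?_⟩, fun i => ?_⟩
  · exact CochainComplex.isStrictlyGE_mappingCone f a a' _ (by simp) (by simp)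
  · rw [CochainComplex.isStrictlyLE_iff]
    intro i hi
    simp only [sup_lt_iff] at hi
    rw [CochainComplex.mappingCone.isZero_X_iff]
    exact ⟨K.isZero_of_isStrictlyLE b _ (by lia), L.isZero_of_isStrictlyLE b' _ (by lia)⟩
  · have := hK.projective (i + 1)
    have := hL.projective i
    constructor
    intro E X g e he
    -- The degree-`i` term of the cone is `K^(i+1) ⊕ L^i`; the lift is made separately on the two
    -- summands.
    refine ⟨(CochainComplex.mappingCone.fst f).1.v i (i + 1) rfl ≫
        Projective.factorThru ((CochainComplex.mappingCone.inl f).v (i + 1) i (by lia) ≫ g) e +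
      (CochainComplex.mappingCone.snd f).v i i (add_zero i) ≫
        Projective.factorThru ((CochainComplex.mappingCone.inr f).f i ≫ g) e, ?_⟩
    rw [CochainComplex.mappingCone.ext_from_iff _ (i + 1) i rfl]
    simp

theorem isBoundedProjectiveComplex_single (P : C) [Projective P] :
    IsBoundedProjectiveComplex ((CochainComplex.singleFunctor C 0).obj P) := by
  refine ⟨⟨0, 0, ?_, ?_⟩, fun i => ?_⟩
  · exact inferInstanceAs (CochainComplex.IsStrictlyGE ((HomologicalComplex.single C _ 0).obj P) 0)
  · exact inferInstanceAs (CochainComplex.IsStrictlyLE ((HomologicalComplex.single C _ 0).obj P) 0)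
  · by_cases hi : i = 0
    · subst hi
      exact Projective.of_iso (HomologicalComplex.singleObjXSelf (ComplexShape.up ℤ) 0 P).symm ‹_›
    · exact (HomologicalComplex.isZero_single_obj_X (ComplexShape.up ℤ) 0 P i hi).projective

variable [HasDerivedCategory C]

variable (C) in
/-- The objects of the derived category which are isomorphic to bounded complexes of projective
objects. -/
def perfectObjects : ObjectProperty (DerivedCategory C) :=
  fun X => ∃ K : CochainComplex C ℤ, IsBoundedProjectiveComplex K ∧ Nonempty (X ≅ Q.obj K)

instance : (perfectObjects C).IsClosedUnderIsomorphisms where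
  of_iso e := by
    rintro ⟨K, hK, ⟨e'⟩⟩
    exact ⟨K, hK, ⟨e.symm ≪≫ e'⟩⟩

instance : (perfectObjects C).IsStableUnderShift ℤ where
  isStableUnderShiftBy n :=
    { le_shift := by
        rintro X ⟨K, hK, ⟨e⟩⟩
        exact ⟨K⟦n⟧, hK.shift n,
          ⟨(shiftFunctor _ n).mapIso e ≪≫ (Q.commShiftIso n).symm.app K⟩⟩ }

/-- The source is K-projective, so derived morphisms out of it are homotopy classes of chain maps.
-/
theorem exists_Q_map_eq {K L : CochainComplex C ℤ} (hK : IsBoundedProjectiveComplex K)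
    (f : Q.obj K ⟶ Q.obj L) : ∃ g : K ⟶ L, Q.map g = f := by
  have := hK.isKProjective
  obtain ⟨g, hg⟩ := (CochainComplex.IsKProjective.Qh_map_bijective K
    ((HomotopyCategory.quotient _ _).obj L)).2
      ((quotientCompQhIso C).hom.app K ≫ f ≫ (quotientCompQhIso C).inv.app L)
  obtain ⟨g, rfl⟩ := (HomotopyCategory.quotient _ _).map_surjective g
  refine ⟨g, ?_⟩
  have := (quotientCompQhIso C).hom.naturality g
  dsimp at this
  rw [hg] at this
  simpa using this.symm

instance : (perfectObjects C).IsTriangulatedClosed₃ := .mk' (by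
  rintro T hT ⟨K, hK, ⟨e⟩⟩ ⟨L, hL, ⟨e'⟩⟩
  obtain ⟨f, hf⟩ := exists_Q_map_eq hK (e.inv ≫ T.mor₁ ≫ e'.hom)
  refine ⟨_, hK.mappingCone hL f, ?_⟩
  have h : T.mor₁ ≫ e'.hom = e.hom ≫ Q.map f := by rw [hf, Iso.hom_inv_id_assoc]
  have h₂ : Q.mapTriangle.obj (CochainComplex.mappingCone.triangle f) ∈
      distTriang (DerivedCategory C) := (mem_distTriang_iff _).2 ⟨_, _, f, ⟨Iso.refl _⟩⟩
  exact ⟨Triangle.π₃.mapIso (isoTriangleOfIso₁₂ T _ hT h₂ e e' h)⟩)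

/-- Induction on the projective dimension: the kernel of a projective cover map onto `M` has smaller
dimension, and `M` is the third vertex of the resulting triangle. -/
theorem perfectObjects_single_of_hasProjectiveDimensionLE [EnoughProjectives C] (n : ℕ) (M : C)
    [hM : HasProjectiveDimensionLE M n] : perfectObjects C ((singleFunctor C 0).obj M) := by
  induction n generalizing M with
  | zero =>
    have := (projective_iff_hasProjectiveDimensionLE_zero M).2 hM
    exact ⟨_, isBoundedProjectiveComplex_single M, ⟨(singleFunctorIsoCompQ C 0).app M⟩⟩
  | succ n ih =>
    let S := ShortComplex.mk (kernel.ι (Projective.π M)) (Projective.π M) (kernel.condition _)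
    have hS : S.ShortExact := { exact := ShortComplex.exact_kernel _ }
    have h₁ : HasProjectiveDimensionLE S.X₁ n :=
      hS.hasProjectiveDimensionLT_X₁ (n + 1) inferInstance hM
    have h₂ : perfectObjects C ((singleFunctor C 0).obj S.X₂) :=
      ⟨_, isBoundedProjectiveComplex_single (Projective.over M),
        ⟨(singleFunctorIsoCompQ C 0).app _⟩⟩
    exact (perfectObjects C).ext_of_isTriangulatedClosed₃ _ hS.singleTriangle_distinguished
      (ih S.X₁) h₂

/-- Induction on the number `n` of degrees available for cohomology; each step splits off the top
cohomology object by truncation. -/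
theorem perfectObjects_of_isGE_of_isLE [EnoughProjectives C]
    (hC : ∀ M : C, ∃ n, HasProjectiveDimensionLE M n) (n : ℕ) (X : DerivedCategory C) (a b : ℤ)
    [X.IsGE a] [X.IsLE b] (h : b < a + n) : perfectObjects C X := by
  have : (perfectObjects C).IsTriangulatedClosed₂ := .of_isTriangulatedClosed₃
  induction n generalizing X b with
  | zero =>
    -- For `n = 0` the bound reads `b < a`, so no cohomology is left.
    have hX : IsZero X := TStructure.t.isZero X b a (by simpa using h)
    refine ⟨0, ⟨⟨0, 0, inferInstance, inferInstance⟩, fun n => ?_⟩,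
      ⟨hX.iso (Functor.map_isZero _ (isZero_zero _))⟩⟩
    exact (Functor.map_isZero (HomologicalComplex.eval C _ n) (isZero_zero _)).projective
  | succ n ih =>
    refine (perfectObjects C).ext_of_isTriangulatedClosed₂ _
      (TStructure.t.triangleLTGE_distinguished b X) ?_ ?_
    · have : (TStructure.t.truncLT b |>.obj X).IsLE (b - 1) := by
        exact TStructure.t.isLE_truncLT_obj X b (b - 1)
      exact ih ((TStructure.t.truncLT b).obj X) (b - 1) (by push_cast at h; lia)
    · obtain ⟨Y, ⟨e⟩⟩ := exists_iso_singleFunctor_obj_of_isGE_of_isLE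
        ((TStructure.t.truncGE b).obj X) b
      obtain ⟨m, _⟩ := hC Y
      refine (perfectObjects C).prop_of_iso e.symm ?_
      exact (perfectObjects C).prop_of_iso
        (((singleFunctors C).shiftIso (-b) b 0 (by lia)).app Y)
        ((perfectObjects C).le_shift (-b) _
          (perfectObjects_single_of_hasProjectiveDimensionLE m Y))

end BoundedProjectiveResolutions

/-! ### Left derived functors on bounded derived categories -/

section BoundedLeftDerived

open DerivedCategory

variable {C : Type*} [Category C] [Abelian C] [HasDerivedCategory C]

instance : (boundedQh C).Additive where
  map_add {X Y f g} := by
    apply ObjectProperty.hom_ext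
    exact (Qh (C := C)).map_add

instance (k : Type*) [Field k] [Linear k C] : (boundedQh C).Linear k where
  map_smul {X Y} f r := by
    apply ObjectProperty.hom_ext
    exact (Qh (C := C)).map_smul r f.hom

theorem boundedQh_map_bijective {K : BoundedHomotopy C}
    (hK : IsBoundedProjectiveComplex K.obj.as) (L : BoundedHomotopy C) :
    Function.Bijective ((boundedQh C).map : (K ⟶ L) → _) := by
  have := hK.isKProjective
  have h := CochainComplex.IsKProjective.Qh_map_bijective K.obj.as L.obj
  constructor
  · intro f g hfg
    exact ObjectProperty.hom_ext _ (h.1 (congrArg (fun φ => φ.hom) hfg))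
  · intro g
    obtain ⟨f, hf⟩ := h.2 g.hom
    exact ⟨ObjectProperty.homMk f, ObjectProperty.hom_ext _ hf⟩

variable [EnoughProjectives C]

theorem exists_boundedQh_obj_iso (hC : ∀ M : C, ∃ n, HasProjectiveDimensionLE M n)
    (X : Bounded C) :
    ∃ K : BoundedHomotopy C, IsBoundedProjectiveComplex K.obj.as ∧
      Nonempty (X ≅ (boundedQh C).obj K) := by
  obtain ⟨X, ⟨a, ha⟩, ⟨b, hb⟩⟩ := X
  obtain ⟨K, hK, ⟨e⟩⟩ := perfectObjects_of_isGE_of_isLE hC (b + 1 - a).toNat X a b (by lia)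
  exact ⟨⟨(HomotopyCategory.quotient _ _).obj K, hK.bounded⟩, hK,
    ⟨ObjectProperty.isoMk _ (e ≪≫ (quotientCompQhIso C).symm.app K)⟩⟩

variable (hC : ∀ M : C, ∃ n, HasProjectiveDimensionLE M n)

/-- A bounded complex of projective objects which represents an object of `D^b(C)`. -/
def projectiveResolutionObj (X : Bounded C) : BoundedHomotopy C :=
  (exists_boundedQh_obj_iso hC X).choose

theorem projectiveResolutionObj_isBoundedProjectiveComplex (X : Bounded C) :
    IsBoundedProjectiveComplex (projectiveResolutionObj hC X).obj.as :=
  (exists_boundedQh_obj_iso hC X).choose_spec.1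

def projectiveResolutionObjIso (X : Bounded C) :
    X ≅ (boundedQh C).obj (projectiveResolutionObj hC X) :=
  (exists_boundedQh_obj_iso hC X).choose_spec.2.some

/-- These bijections are natural in `L`, which is all that is needed to make the chosen resolutions
into a left adjoint functor. -/
def projectiveResolutionHomEquiv (X : Bounded C) (L : BoundedHomotopy C) :
    (projectiveResolutionObj hC X ⟶ L) ≃ (X ⟶ (boundedQh C).obj L) :=
  (Equiv.ofBijective _ (boundedQh_map_bijective
    (projectiveResolutionObj_isBoundedProjectiveComplex hC X) L)).trans
      ((projectiveResolutionObjIso hC X).symm.homFromEquiv)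

/-- The left adjoint of `K^b(C) ⥤ D^b(C)`, given by projective resolutions. -/
def projectiveResolutionFunctor : Bounded C ⥤ BoundedHomotopy C :=
  Adjunction.leftAdjointOfEquiv (projectiveResolutionHomEquiv hC) (by
    intros; simp [projectiveResolutionHomEquiv])

def projectiveResolutionAdjunction : projectiveResolutionFunctor hC ⊣ boundedQh C :=
  Adjunction.adjunctionOfEquivLeft _ _

end BoundedLeftDerived

/-- Right Kan extension along a right adjoint `L` is precomposition with its left adjoint `p`. One
triangle identity gives the factorisation, the other its uniqueness. This is why resolving and then
applying `F` is the left derived functor. -/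
theorem CategoryTheory.Adjunction.isRightKanExtension_comp {C D E : Type*} [Category C] [Category D]
    [Category E] {p : D ⥤ C} {L : C ⥤ D} (adj : p ⊣ L) (G : C ⥤ E) :
    (p ⋙ G).IsRightKanExtension
      ((Functor.associator _ _ _).inv ≫ Functor.whiskerRight adj.counit G ≫ G.leftUnitor.hom) := by
  refine ⟨⟨IsTerminal.ofUniqueHom (fun T => ?_) (fun T m => ?_)⟩⟩
  · refine CostructuredArrow.homMk (T.left.leftUnitor.inv ≫ Functor.whiskerRight adj.unit _ ≫
      (Functor.associator _ _ _).hom ≫ Functor.whiskerLeft p T.hom) ?_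
    refine NatTrans.ext (funext fun X => ?_)
    have h := T.hom.naturality (adj.counit.app X)
    change (𝟙 _ ≫ T.left.map (adj.unit.app _) ≫ 𝟙 _ ≫ T.hom.app _) ≫
      𝟙 _ ≫ G.map (adj.counit.app X) ≫ 𝟙 _ = T.hom.app X
    simp only [Category.id_comp, Category.comp_id, Category.assoc]
    refine (congrArg (T.left.map (adj.unit.app (L.obj X)) ≫ ·) h.symm).trans ?_
    change T.left.map (adj.unit.app (L.obj X)) ≫ T.left.map (L.map (adj.counit.app X)) ≫ _ = _
    rw [← Functor.map_comp_assoc, adj.right_triangle_components]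
    simp
  · apply CostructuredArrow.hom_ext
    refine NatTrans.ext (funext fun X => ?_)
    let n : T.left ⟶ p ⋙ G := m.left
    have h : n.app (L.obj (p.obj X)) ≫ G.map (adj.counit.app (p.obj X)) =
        T.hom.app (p.obj X) := by
      refine Eq.trans ?_ (NatTrans.congr_app (CostructuredArrow.w m) (p.obj X))
      change _ = n.app _ ≫ 𝟙 _ ≫ G.map (adj.counit.app (p.obj X)) ≫ 𝟙 (G.obj (p.obj X))
      rw [Category.id_comp]
      exact congrArg _ (Category.comp_id _).symm
    change n.app X = 𝟙 _ ≫ T.left.map (adj.unit.app X) ≫ 𝟙 _ ≫ T.hom.app (p.obj X)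
    have h' : T.left.map (adj.unit.app X) ≫ n.app (L.obj (p.obj X)) =
      n.app X ≫ G.map (p.map (adj.unit.app X)) := n.naturality (adj.unit.app X)
    rw [← h, Category.id_comp, Category.id_comp, reassoc_of% h', ← G.map_comp,
      adj.left_triangle_components, G.map_id, Category.comp_id]


/-! ### Derived functors computed by resolutions, and their restriction to projective objects -/

section BoundedLeftDerived

open DerivedCategory

variable {C : Type*} [Category C] [Abelian C] [HasDerivedCategory C]

theorem IsBoundedLeftDerived.nonempty_iso {F : C ⥤ C} [F.Additive] {LF LF' : Bounded C ⥤ Bounded C}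
    (h : IsBoundedLeftDerived F LF) (h' : IsBoundedLeftDerived F LF') : Nonempty (LF ≅ LF') := by
  obtain ⟨α, _⟩ := h
  obtain ⟨α', _⟩ := h'
  exact ⟨Functor.rightKanExtensionUnique _ α _ α'⟩

variable (C) in
/-- The functor `C ⥤ K^b(C)` which sends an object to the complex concentrated in degree `0`. -/
def boundedSingle : C ⥤ BoundedHomotopy C :=
  (boundedHomotopyObjects C).lift (HomotopyCategory.singleFunctor C 0) (fun M => by
    refine ⟨0, 0, ?_, ?_⟩
    · exact inferInstanceAs
        (CochainComplex.IsStrictlyGE ((HomologicalComplex.single C _ 0).obj M) 0)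
    · exact inferInstanceAs
        (CochainComplex.IsStrictlyLE ((HomologicalComplex.single C _ 0).obj M) 0))

variable (C) in
def boundedSingleCompQhIso :
    (boundedSingle C ⋙ boundedQh C) ⋙ Bounded.ι ≅ singleFunctor C 0 :=
  Iso.refl _

/-- Fullness and faithfulness descend from the degree-`0` embedding into the unbounded derived
category. -/
instance : (boundedSingle C ⋙ boundedQh C).Full := by
  have : ((boundedSingle C ⋙ boundedQh C) ⋙ Bounded.ι).Full :=
    Functor.Full.of_iso (boundedSingleCompQhIso C).symm
  exact Functor.Full.of_comp_faithful _ (Bounded.ι (C := C))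

instance : (boundedSingle C ⋙ boundedQh C).Faithful := by
  have : ((boundedSingle C ⋙ boundedQh C) ⋙ Bounded.ι).Faithful :=
    Functor.Faithful.of_iso (boundedSingleCompQhIso C).symm
  exact Functor.Faithful.of_comp _ (Bounded.ι (C := C))

def boundedSingleCompMapIso (F : C ⥤ C) [F.Additive] :
    boundedSingle C ⋙ mapBoundedHomotopy F ≅ F ⋙ boundedSingle C :=
  NatIso.ofComponents (fun M => ObjectProperty.isoMk _ ((HomotopyCategory.quotient _ _).mapIso
      ((HomologicalComplex.singleMapHomologicalComplex F (ComplexShape.up ℤ) 0).app M)))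
    (fun {M N} f => by
      apply ObjectProperty.hom_ext
      have := (HomologicalComplex.singleMapHomologicalComplex F
        (ComplexShape.up ℤ) 0).hom.naturality f
      exact congrArg (HomotopyCategory.quotient _ _).map this)

instance (F : C ⥤ C) [F.Additive] : (mapBoundedHomotopy F).Additive where
  map_add {X Y f g} := by
    apply ObjectProperty.hom_ext
    exact (F.mapHomotopyCategory (ComplexShape.up ℤ)).map_add

variable [EnoughProjectives C]
  (hC : ∀ M : C, ∃ n, HasProjectiveDimensionLE M n)

theorem projectiveResolutionFunctor_obj (X : Bounded C) :
    IsBoundedProjectiveComplex ((projectiveResolutionFunctor hC).obj X).obj.as :=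
  projectiveResolutionObj_isBoundedProjectiveComplex hC X

theorem isBoundedLeftDerived_projectiveResolutionFunctor (F : C ⥤ C) [F.Additive] :
    IsBoundedLeftDerived F
      (projectiveResolutionFunctor hC ⋙ mapBoundedHomotopy F ⋙ boundedQh C) :=
  ⟨_, (projectiveResolutionAdjunction hC).isRightKanExtension_comp _⟩

instance projectiveResolutionAdjunction_unit_isIso (X : Bounded C) :
    IsIso ((projectiveResolutionAdjunction hC).unit.app X) := by
  have : (projectiveResolutionAdjunction hC).unit.app X = (projectiveResolutionObjIso hC X).hom := by
    have h : (projectiveResolutionAdjunction hC).unit.app X =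
        projectiveResolutionHomEquiv hC X _ (𝟙 (projectiveResolutionObj hC X)) := rfl
    rw [h]
    change (projectiveResolutionObjIso hC X).hom ≫ (boundedQh C).map (𝟙 _) = _
    rw [CategoryTheory.Functor.map_id, Category.comp_id]
  rw [this]
  exact (projectiveResolutionObjIso hC X).isIso_hom

/-- The localisation is bijective on morphisms out of projective complexes, so the unit lifts to a
morphism in `K^b`, and this lift inverts the counit. -/
theorem projectiveResolutionAdjunction_counit_isIso (K : BoundedHomotopy C)
    (hK : IsBoundedProjectiveComplex K.obj.as) :
    IsIso ((projectiveResolutionAdjunction hC).counit.app K) := by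
  let η := (projectiveResolutionAdjunction hC).unit.app ((boundedQh C).obj K)
  let ε : (projectiveResolutionFunctor hC).obj ((boundedQh C).obj K) ⟶ K :=
    (projectiveResolutionAdjunction hC).counit.app K
  obtain ⟨g, hg⟩ := (boundedQh_map_bijective hK _).2 η
  have h : η ≫ (boundedQh C).map ε = 𝟙 _ :=
    (projectiveResolutionAdjunction hC).right_triangle_components K
  have h₁ : (boundedQh C).map (ε ≫ g) = (boundedQh C).map (𝟙 _) := by
    rw [Functor.map_comp, CategoryTheory.Functor.map_id, hg, ← cancel_epi η, reassoc_of% h]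
    exact (Category.comp_id _).symm
  have h₂ : (boundedQh C).map (g ≫ ε) = (boundedQh C).map (𝟙 _) := by
    rw [Functor.map_comp, hg, h, CategoryTheory.Functor.map_id]
    rfl
  exact ⟨g, (boundedQh_map_bijective (projectiveResolutionFunctor_obj hC _) _).1 h₁,
    (boundedQh_map_bijective hK _).1 h₂⟩

/-- The total left derived functor of `F` agrees with `F` on projective objects. -/
theorem IsBoundedLeftDerived.nonempty_iso_comp_boundedSingle {F : C ⥤ C} [F.Additive]
    {LF : Bounded C ⥤ Bounded C} (hC : ∀ M : C, ∃ n, HasProjectiveDimensionLE M n)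
    (h : IsBoundedLeftDerived F LF) :
    Nonempty ((isProjective C).ι ⋙ (boundedSingle C ⋙ boundedQh C) ⋙ LF ≅
      (isProjective C).ι ⋙ F ⋙ (boundedSingle C ⋙ boundedQh C)) := by
  obtain ⟨e⟩ := h.nonempty_iso (isBoundedLeftDerived_projectiveResolutionFunctor hC F)
  let c : (isProjective C).ι ⋙ boundedSingle C ⋙ boundedQh C ⋙ projectiveResolutionFunctor hC ≅
      (isProjective C).ι ⋙ boundedSingle C :=
    NatIso.ofComponents (fun P =>
      haveI := projectiveResolutionAdjunction_counit_isIso hC ((boundedSingle C).obj P.obj)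
        (haveI : Projective P.obj := P.property; isBoundedProjectiveComplex_single P.obj)
      asIso ((projectiveResolutionAdjunction hC).counit.app ((boundedSingle C).obj P.obj)))
      (fun f => (projectiveResolutionAdjunction hC).counit.naturality _)
  exact ⟨Functor.isoWhiskerLeft ((isProjective C).ι ⋙ boundedSingle C ⋙ boundedQh C) e ≪≫
    Functor.isoWhiskerRight c (mapBoundedHomotopy F ⋙ boundedQh C) ≪≫
    Functor.isoWhiskerLeft (isProjective C).ι
      (Functor.isoWhiskerRight (boundedSingleCompMapIso F) (boundedQh C))⟩

end BoundedLeftDerived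

/-! ### Serre traces -/

/-- A Serre trace for a functor `F` on the objects with the property `P`: linear forms on
`Hom(X, F X)` for which the pairings `Hom(M, F X) × Hom(X, M) → k` represent `Hom(X, -)^*`. -/
structure SerreTrace (k : Type*) [Field k] {C : Type*} [Category C] [Preadditive C] [Linear k C]
    (F : C ⥤ C) (P : ObjectProperty C) where
  /-- the trace form -/
  tr (X : C) (hX : P X) : (X ⟶ F.obj X) →ₗ[k] k
  tr_comp_map {X Y : C} (hX : P X) (hY : P Y) (g : X ⟶ Y) (u : Y ⟶ F.obj X) :
    tr Y hY (u ≫ F.map g) = tr X hX (g ≫ u)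
  bijective (M X : C) (hX : P X) : Function.Bijective
    fun h : M ⟶ F.obj X => (tr X hX ∘ₗ Linear.rightComp k X h : Module.Dual k (X ⟶ M))

namespace SerreTrace

variable {k : Type*} [Field k] {C : Type*} [Category C] [Preadditive C] [Linear k C]
  {F F' : C ⥤ C} {P : ObjectProperty C}

theorem hom_ext (t : SerreTrace k F P) {M X : C} (hX : P X) {h h' : M ⟶ F.obj X}
    (H : ∀ g : X ⟶ M, t.tr X hX (g ≫ h) = t.tr X hX (g ≫ h')) : h = h' :=
  (t.bijective M X hX).1 (LinearMap.ext H)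

theorem exists_hom (t : SerreTrace k F P) {M X : C} (hX : P X) (ξ : Module.Dual k (X ⟶ M)) :
    ∃ h : M ⟶ F.obj X, ∀ g : X ⟶ M, t.tr X hX (g ≫ h) = ξ g := by
  obtain ⟨h, hh⟩ := (t.bijective M X hX).2 ξ
  exact ⟨h, fun g => LinearMap.congr_fun hh g⟩

/-- A Serre trace for `F` on all objects, as a duality. -/
def toSerreDuality (t : SerreTrace k F P) (hP : ∀ X, P X) : SerreDuality k F where
  iso X Y := LinearEquiv.ofBijective
    { toFun h := t.tr Y (hP Y) ∘ₗ Linear.rightComp k Y h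
      map_add' h h' := by ext g; simp
      map_smul' c h := by ext g; simp } (t.bijective X Y (hP Y))
  naturality_left f h g := by simp
  naturality_right {X Y Y'} g h s := by
    have := t.tr_comp_map (hP Y) (hP Y') g (s ≫ h)
    simpa using this

end SerreTrace

/-- The Serre trace given by a Serre duality. -/
def SerreDuality.toSerreTrace {k : Type*} [Field k] {C : Type*} [Category C] [Preadditive C]
    [Linear k C] {F : C ⥤ C} (d : SerreDuality k F) : SerreTrace k F ⊤ where
  tr X _ := LinearMap.applyₗ (𝟙 X) ∘ₗ (d.iso X X).toLinearMap
  tr_comp_map {X Y} _ _ g u := by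
    have h₁ := d.naturality_right g u (𝟙 Y)
    have h₂ := d.naturality_left g u (𝟙 X)
    simp only [Category.comp_id, Category.id_comp] at h₁ h₂
    simpa [h₁] using h₂.symm
  bijective M X _ := by
    convert (d.iso M X).bijective using 1
    funext h
    ext g
    have := d.naturality_left g h (𝟙 X)
    simpa using this

namespace SerreTrace

variable {k : Type*} [Field k] {C : Type*} [Category C] [Preadditive C] [Linear k C]
  {F F' : C ⥤ C} {P : ObjectProperty C}

/-- Transport of a Serre trace along an isomorphism of functors. -/
def ofIso (t : SerreTrace k F' P) (e : P.ι ⋙ F ≅ P.ι ⋙ F') : SerreTrace k F P where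
  tr X hX := t.tr X hX ∘ₗ Linear.rightComp k X (e.hom.app ⟨X, hX⟩)
  tr_comp_map {X Y} hX hY g u := by
    have h := e.hom.naturality (X := ⟨X, hX⟩) (Y := ⟨Y, hY⟩) (ObjectProperty.homMk g)
    have h' := t.tr_comp_map hX hY g (u ≫ e.hom.app ⟨X, hX⟩)
    change F.map g ≫ e.hom.app ⟨Y, hY⟩ = e.hom.app ⟨X, hX⟩ ≫ F'.map g at h
    change t.tr Y hY ((u ≫ F.map g) ≫ _) = t.tr X hX ((g ≫ u) ≫ _)
    rw [Category.assoc, h, Category.assoc, ← h', Category.assoc]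
  bijective M X hX := by
    have h₁ : Function.Bijective fun h : M ⟶ F.obj X => h ≫ e.hom.app ⟨X, hX⟩ :=
      ((e.app ⟨X, hX⟩).homToEquiv (Z := M)).bijective
    convert (t.bijective M X hX).comp h₁ using 1
    funext h
    ext g
    exact congrArg (t.tr X hX) (Category.assoc g h _)

/-- Only existence is recorded; uniqueness is `hom_ext`. -/
theorem exists_unique_comparison (t : SerreTrace k F P) (t' : SerreTrace k F' P) (X : C)
    (hX : P X) :
    ∃ e : F.obj X ⟶ F'.obj X, ∀ g : X ⟶ F.obj X, t'.tr X hX (g ≫ e) = t.tr X hX g :=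
  t'.exists_hom hX (t.tr X hX)

/-- A functor with a Serre trace is determined by the trace property. -/
theorem nonempty_iso (t : SerreTrace k F P) (t' : SerreTrace k F' P) :
    Nonempty (P.ι ⋙ F ≅ P.ι ⋙ F') := by
  choose e he using t.exists_unique_comparison t'
  choose e' he' using t'.exists_unique_comparison t
  refine ⟨NatIso.ofComponents (fun X =>
    { hom := e X.obj X.property
      inv := e' X.obj X.property
      hom_inv_id := t.hom_ext X.property fun g => ?_
      inv_hom_id := t'.hom_ext X.property fun g => ?_ }) (fun {X Y} f => ?_)⟩
  · refine (congrArg _ (Category.assoc _ _ _).symm).trans ((he' _ _ _).trans ((he _ _ _).trans ?_))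
    exact congrArg _ (Category.comp_id g).symm
  · refine (congrArg _ (Category.assoc _ _ _).symm).trans ((he _ _ _).trans ((he' _ _ _).trans ?_))
    exact congrArg _ (Category.comp_id g).symm
  -- Naturality is tested against the trace: cyclicity of both traces turns the two sides into the
  -- same number.
  · refine t'.hom_ext Y.property fun g => ?_
    change t'.tr Y.obj Y.property (g ≫ F.map f.hom ≫ e Y.obj Y.property) =
      t'.tr Y.obj Y.property (g ≫ e X.obj X.property ≫ F'.map f.hom)
    rw [← Category.assoc, he, t.tr_comp_map X.property Y.property, ← Category.assoc,
      t'.tr_comp_map X.property Y.property, ← Category.assoc, he]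

/-- By cyclicity `tr (f ≫ h) = tr (h ≫ F f)`, so `F f` determines the value at `f` of every
functional on `Hom(X, Y)`. -/
theorem map_injective (t : SerreTrace k F P) {X Y : C} (hX : P X) (hY : P Y) :
    Function.Injective (F.map : (X ⟶ Y) → _) := by
  intro f g hfg
  by_contra hne
  obtain ⟨ξ, hξ⟩ : ∃ ξ : Module.Dual k (X ⟶ Y), ξ f ≠ ξ g := by
    by_contra! h
    exact hne ((Module.forall_dual_apply_eq_zero_iff k (f - g)).1 (by simp [h]) |> sub_eq_zero.1)
  obtain ⟨h, hh⟩ := t.exists_hom hX ξ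
  apply hξ
  rw [← hh, ← hh, ← t.tr_comp_map hX hY, ← t.tr_comp_map hX hY, hfg]

/-- Since `Hom(Y, F X)` is the dual of `Hom(X, Y)`, the functional `u ↦ tr (u ≫ w)` on it is
evaluation at some `g` by finite-dimensionality. Cyclicity then shows that `F g` and `w` have the
same traces. -/
theorem map_surjective (t : SerreTrace k F P) {X Y : C} (hX : P X) (hY : P Y)
    [FiniteDimensional k (X ⟶ Y)] : Function.Surjective (F.map : (X ⟶ Y) → _) := by
  intro w
  let β : (Y ⟶ F.obj X) ≃ₗ[k] Module.Dual k (X ⟶ Y) := LinearEquiv.ofBijective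
    { toFun h := t.tr X hX ∘ₗ Linear.rightComp k X h
      map_add' h h' := by ext g; simp
      map_smul' c h := by ext g; simp } (t.bijective Y X hX)
  obtain ⟨g, hg⟩ := (Module.evalEquiv k (X ⟶ Y)).surjective
    ((t.tr Y hY ∘ₗ Linear.rightComp k Y w) ∘ₗ β.symm.toLinearMap)
  refine ⟨g, t.hom_ext hY fun u => ?_⟩
  have := LinearMap.congr_fun hg (β u)
  simp only [LinearMap.comp_apply, LinearEquiv.coe_coe, LinearEquiv.symm_apply_apply,
    Module.evalEquiv_apply, Module.Dual.eval_apply] at this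
  rw [t.tr_comp_map hX hY]
  exact this

/-- Composition with a monomorphism is injective on `Hom(X, -)`, so its transpose is surjective;
under the duality this is extension of maps to `F X`. -/
theorem injective_obj (t : SerreTrace k F P) {X : C} (hX : P X) : Injective (F.obj X) where
  factors {M N} h i _ := by
    have hi : Function.Injective (Linear.rightComp k X i) := fun a b hab =>
      (cancel_mono i).1 hab
    obtain ⟨ξ, hξ⟩ := LinearMap.dualMap_surjective_of_injective hi
      (t.tr X hX ∘ₗ Linear.rightComp k X h)
    obtain ⟨h', hh'⟩ := t.exists_hom hX ξ
    refine ⟨h', t.hom_ext hX fun g => ?_⟩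
    rw [← Category.assoc, hh']
    exact LinearMap.congr_fun hξ g

/-- A vector space and its dual vanish together. For simple `M` this compares the socle of `F X`
with the head of `X`. -/
theorem exists_ne_zero_iff (t : SerreTrace k F P) {M X : C} (hX : P X) :
    (∃ h : M ⟶ F.obj X, h ≠ 0) ↔ ∃ g : X ⟶ M, g ≠ 0 := by
  constructor
  · rintro ⟨h, hh⟩
    by_contra! H
    exact hh (t.hom_ext hX fun g => by simp [H g])
  · rintro ⟨g, hg⟩
    by_contra! H
    refine hg ((Module.forall_dual_apply_eq_zero_iff k g).1 fun ξ => ?_)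
    obtain ⟨h, hh⟩ := t.exists_hom hX ξ
    rw [← hh, H h]
    simp

end SerreTrace

/-! ### Supertraces on complexes of projective objects -/

section Supertrace

/-- Only finitely many factors are nonzero, so the product is a direct sum and functionals on it
split into components. -/
theorem Module.Dual.apply_eq_finsum {k : Type*} [Field k] {ι : Type*} [DecidableEq ι]
    {E : ι → Type*} [∀ i, AddCommGroup (E i)] [∀ i, Module k (E i)] (S : Finset ι)
    (hS : ∀ i ∉ S, Subsingleton (E i)) (ξ : Module.Dual k (∀ i, E i)) (t : ∀ i, E i) :
    ξ t = ∑ᶠ i, ξ (Pi.single i (t i)) := by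
  have h : t = ∑ i ∈ S, Pi.single i (t i) := by
    ext j
    rw [Finset.sum_apply]
    by_cases hj : j ∈ S
    · rw [Finset.sum_eq_single_of_mem j hj fun i _ hij => Pi.single_eq_of_ne hij.symm _,
        Pi.single_eq_same]
    · have := hS j hj
      exact Subsingleton.elim _ _
  conv_lhs => rw [h, map_sum]
  refine (finsum_eq_sum_of_support_subset _ fun i hi => ?_).symm
  by_contra hi'
  have := hS i hi'
  exact hi (by simp [Subsingleton.elim (t i) 0])

variable {k : Type*} [Field k] {C : Type*} [Category C] [Abelian C] [Linear k C]
  {F : C ⥤ C}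

/-- The sign `(-1)^p` in `k`. -/
def koszulSign (k : Type*) [Field k] (p : ℤ) : k := ((p.negOnePow : ℤ) : k)

theorem koszulSign_succ (p : ℤ) : koszulSign k (p + 1) = - koszulSign k p := by
  simp [koszulSign, Int.negOnePow_succ]

theorem koszulSign_mul_self (p : ℤ) : koszulSign k p * koszulSign k p = 1 := by
  rw [koszulSign, ← Int.cast_mul, ← Units.val_mul, Int.units_mul_self]
  simp

theorem IsBoundedProjectiveComplex.exists_finset {R : CochainComplex C ℤ}
    (hR : IsBoundedProjectiveComplex R) : ∃ S : Finset ℤ, ∀ p ∉ S, IsZero (R.X p) := by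
  obtain ⟨a, b, _, _⟩ := hR.bounded
  refine ⟨Finset.Icc a b, fun p hp => ?_⟩
  rw [Finset.mem_Icc, not_and_or, not_le, not_le] at hp
  rcases hp with hp | hp
  · exact R.isZero_of_isStrictlyGE a p hp
  · exact R.isZero_of_isStrictlyLE b p hp

variable (t : SerreTrace k F (isProjective C)) {R M : CochainComplex C ℤ}
  (hR : IsBoundedProjectiveComplex R)

/-- The alternating sum of the traces of the components of a family of maps `R^p ⟶ F(R^p)`. -/
def supertrace (u : ∀ p, R.X p ⟶ F.obj (R.X p)) : k :=
  ∑ᶠ p, koszulSign k p * t.tr (R.X p) (hR.projective p) (u p)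

theorem hasFiniteSupport_of_isBoundedProjectiveComplex (u : ∀ p, R.X p ⟶ F.obj (R.X p)) :
    (Function.support fun p =>
      koszulSign k p * t.tr (R.X p) (hR.projective p) (u p)).Finite := by
  obtain ⟨S, hS⟩ := hR.exists_finset
  refine S.finite_toSet.subset fun p hp => ?_
  by_contra h
  exact hp (by simp [(hS p h).eq_of_src (u p) 0])

theorem supertrace_add (u v : ∀ p, R.X p ⟶ F.obj (R.X p)) :
    supertrace t hR (fun p => u p + v p) = supertrace t hR u + supertrace t hR v := by
  unfold supertrace
  rw [← finsum_add_distrib (hasFiniteSupport_of_isBoundedProjectiveComplex t hR u)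
    (hasFiniteSupport_of_isBoundedProjectiveComplex t hR v)]
  simp [mul_add]

theorem supertrace_smul (c : k) (u : ∀ p, R.X p ⟶ F.obj (R.X p)) :
    supertrace t hR (fun p => c • u p) = c * supertrace t hR u := by
  unfold supertrace
  rw [mul_finsum]
  simp [mul_left_comm]

/-- A linear form on families of maps `R^p ⟶ M^p` is the supertrace against a unique family of
maps `M^p ⟶ F(R^p)`. -/
theorem exists_supertrace_eq (ξ : Module.Dual k (∀ p, R.X p ⟶ M.X p)) :
    ∃ f : ∀ p, M.X p ⟶ F.obj (R.X p), ∀ v : ∀ p, R.X p ⟶ M.X p,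
      ξ v = supertrace t hR fun p => v p ≫ f p := by
  -- The sign put into the functional cancels the one in the supertrace, as its square is `1`.
  have h (p : ℤ) := t.exists_hom (hR.projective p)
    (koszulSign k p • (ξ ∘ₗ LinearMap.single k (fun p => R.X p ⟶ M.X p) p))
  choose f hf using h
  obtain ⟨S, hS⟩ := hR.exists_finset
  refine ⟨f, fun v => ?_⟩
  rw [Module.Dual.apply_eq_finsum S fun p hp => ⟨fun a b => (hS p hp).eq_of_src a b⟩]
  refine finsum_congr fun p => ?_
  rw [hf, LinearMap.smul_apply, smul_eq_mul, ← mul_assoc, koszulSign_mul_self, one_mul]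
  rfl

theorem supertrace_eq_add (u : ∀ p, R.X p ⟶ F.obj (R.X p)) (q : ℤ)
    (hu : ∀ p, p ≠ q → p ≠ q + 1 → u p = 0) :
    supertrace t hR u = koszulSign k q * (t.tr (R.X q) (hR.projective q) (u q) -
      t.tr (R.X (q + 1)) (hR.projective (q + 1)) (u (q + 1))) := by
  unfold supertrace
  rw [finsum_eq_sum_of_support_subset (s := {q, q + 1})]
  · rw [Finset.sum_pair (by lia), koszulSign_succ]
    ring
  · intro p hp
    by_contra h
    simp only [Finset.coe_insert, Finset.coe_singleton, Set.mem_insert_iff,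
      Set.mem_singleton_iff, not_or] at h
    exact hp (by simp [hu p h.1 h.2])

variable [F.Additive]

/-- The supertrace as a linear form on chain maps `R ⟶ F(R)`. -/
def supertraceHom :
    (R ⟶ (F.mapHomologicalComplex (ComplexShape.up ℤ)).obj R) →ₗ[k] k where
  toFun u := supertrace t hR u.f
  map_add' u v := supertrace_add t hR u.f v.f
  map_smul' c u := supertrace_smul t hR c u.f

theorem supertraceHom_comp_map {R' : CochainComplex C ℤ} (hR' : IsBoundedProjectiveComplex R')
    (g : R ⟶ R') (u : R' ⟶ (F.mapHomologicalComplex (ComplexShape.up ℤ)).obj R) :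
    supertraceHom t hR' (u ≫ (F.mapHomologicalComplex _).map g) =
      supertraceHom t hR (g ≫ u) := by
  refine finsum_congr fun p => ?_
  congr 1
  exact t.tr_comp_map (hR.projective p) (hR'.projective p) (g.f p) (u.f p)

/-- A null-homotopic map is a sum of two terms `d ≫ s` and `s ≫ F d` in each degree. Cyclicity
identifies the trace of the second with that of the first one degree lower, and the alternating
signs cancel them. -/
theorem supertraceHom_eq_zero_of_homotopy
    (u : R ⟶ (F.mapHomologicalComplex (ComplexShape.up ℤ)).obj R) (h : Homotopy u 0) :
    supertraceHom t hR u = 0 := by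
  let s (p : ℤ) : R.X (p + 1) ⟶ F.obj (R.X p) := h.hom (p + 1) p
  let u' (p : ℤ) : R.X p ⟶ F.obj (R.X p) := u.f p
  have hu (p : ℤ) : u' (p + 1) = R.d (p + 1) (p + 1 + 1) ≫ s (p + 1) +
      s p ≫ F.map (R.d p (p + 1)) := by
    have := h.comm (p + 1)
    rw [dNext_eq h.hom (show (ComplexShape.up ℤ).Rel (p + 1) (p + 1 + 1) from rfl),
      prevD_eq h.hom (show (ComplexShape.up ℤ).Rel p (p + 1) from rfl)] at this
    rw [HomologicalComplex.zero_f, add_zero] at this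
    exact this
  let v (p : ℤ) : R.X p ⟶ F.obj (R.X p) := R.d p (p + 1) ≫ s p
  let w (p : ℤ) : R.X p ⟶ F.obj (R.X p) := u' p - v p
  have hw : supertrace t hR w = - supertrace t hR v := by
    unfold supertrace
    rw [← finsum_neg_distrib, ← finsum_comp_equiv (Equiv.addRight (1 : ℤ))]
    refine finsum_congr fun p => ?_
    have h₁ : w (p + 1) = s p ≫ F.map (R.d p (p + 1)) := by
      simp only [w, v, hu, add_sub_cancel_left]
    rw [Equiv.coe_addRight, h₁, koszulSign_succ, neg_mul, t.tr_comp_map (hR.projective p)]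
  have : u' = fun p => v p + w p := by
    ext p
    simp [w]
  change supertrace t hR u' = 0
  rw [this, supertrace_add, hw, add_neg_cancel]

variable (R M) in
/-- The inclusion of the chain maps into the families of maps. -/
def chainMapInclusion : (R ⟶ M) →ₗ[k] ∀ p, R.X p ⟶ M.X p where
  toFun f := f.f
  map_add' _ _ := rfl
  map_smul' _ _ := rfl

theorem chainMapInclusion_injective : Function.Injective (chainMapInclusion (k := k) R M) :=
  fun _ _ h => HomologicalComplex.hom_ext _ _ fun p => congrFun h p

/-- Extend `ξ` to all families of maps and represent the extension by a family `f`. Vanishing on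
null-homotopic maps is exactly what forces `f` to commute with the differentials. -/
theorem exists_chainMap_supertraceHom_eq (ξ : Module.Dual k (R ⟶ M))
    (hξ : ∀ v : R ⟶ M, Nonempty (Homotopy v 0) → ξ v = 0) :
    ∃ f : M ⟶ (F.mapHomologicalComplex (ComplexShape.up ℤ)).obj R,
      ∀ v : R ⟶ M, supertraceHom t hR (v ≫ f) = ξ v := by
  obtain ⟨ξ', rfl⟩ := LinearMap.dualMap_surjective_of_injective
    (chainMapInclusion_injective (k := k) (R := R) (M := M)) ξ
  obtain ⟨f, hf⟩ := exists_supertrace_eq t hR ξ'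
  have hcomm (q : ℤ) : f q ≫ F.map (R.d q (q + 1)) = M.d q (q + 1) ≫ f (q + 1) := by
    refine t.hom_ext (hR.projective (q + 1)) fun s => ?_
    -- A homotopy with the single component `s : R^(q+1) ⟶ M^q`; its null-homotopic map lives only
    -- in degrees `q` and `q + 1`, where its supertrace compares the two sides of `hcomm`.
    let s' : ∀ i j, R.X i ⟶ M.X j :=
      Pi.single (M := fun i => ∀ j, R.X i ⟶ M.X j) (q + 1) (Pi.single q s)
    have hs : s' (q + 1) q = s := by simp [s']
    have hs' (i j : ℤ) (hij : i ≠ q + 1) : s' i j = 0 := by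
      simp [s', Pi.single_eq_of_ne hij]
    have hs'' (i j : ℤ) (hij : j ≠ q) : s' i j = 0 := by
      by_cases hi : i = q + 1
      · subst hi
        simp [s', Pi.single_eq_of_ne hij]
      · exact hs' i j hi
    have h0 : ∀ i j, ¬ (ComplexShape.up ℤ).Rel j i → s' i j = 0 := fun i j hij => by
      by_cases hi : i = q + 1
      · exact hs'' i j fun hj => hij (by simp [hi, hj])
      · exact hs' i j hi
    have h₁ := hξ _ ⟨Homotopy.nullHomotopy s' h0⟩
    have hv (p : ℤ) : (Homotopy.nullHomotopicMap s').f (p + 1) =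
        R.d (p + 1) (p + 1 + 1) ≫ s' (p + 1 + 1) (p + 1) + s' (p + 1) p ≫ M.d p (p + 1) :=
      Homotopy.nullHomotopicMap_f (c := ComplexShape.up ℤ) rfl rfl _
    have hvq : (Homotopy.nullHomotopicMap s').f q = R.d q (q + 1) ≫ s := by
      rw [Homotopy.nullHomotopicMap_f (c := ComplexShape.up ℤ) (k₂ := q - 1) (k₀ := q + 1)
        (by simp) rfl, hs, hs' q _ (by lia), zero_comp, add_zero]
    have hvq' : (Homotopy.nullHomotopicMap s').f (q + 1) = s ≫ M.d q (q + 1) := by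
      rw [hv, hs, hs' _ _ (by lia), comp_zero, zero_add]
    have hv0 (p : ℤ) (h₁ : p ≠ q) (h₂ : p ≠ q + 1) :
        (Homotopy.nullHomotopicMap s').f p = 0 := by
      obtain ⟨p, rfl⟩ : ∃ r, p = r + 1 := ⟨p - 1, by lia⟩
      rw [hv, hs' (p + 1) p h₂, hs'' _ (p + 1) h₁, zero_comp, comp_zero, add_zero]
    have h₂ := (hf (Homotopy.nullHomotopicMap s').f).symm.trans h₁
    rw [supertrace_eq_add t hR _ q fun p h₁ h₂ => by rw [hv0 p h₁ h₂, zero_comp]] at h₂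
    have h₃ : koszulSign k q ≠ 0 := fun h => by simpa [h] using koszulSign_mul_self (k := k) q
    have h₄ := sub_eq_zero.1 ((mul_eq_zero.1 h₂).resolve_left h₃)
    rw [hvq, hvq', Category.assoc, Category.assoc] at h₄
    rw [← Category.assoc, t.tr_comp_map (hR.projective q), h₄]
  refine ⟨{ f := f, comm' := ?_ }, fun v => (hf v.f).symm⟩
  rintro i j rfl
  exact hcomm i

/-- The functional `v ↦ supertrace (v ≫ f)` vanishes on chain maps, the kernel of `δ`, so it factors
through `δ`. The maps representing the factor `η` are, up to sign, the homotopy. -/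
theorem exists_homotopy_of_supertraceHom_eq_zero
    (f : M ⟶ (F.mapHomologicalComplex (ComplexShape.up ℤ)).obj R)
    (hf : ∀ v : R ⟶ M, supertraceHom t hR (v ≫ f) = 0) : Nonempty (Homotopy f 0) := by
  let f' (p : ℤ) : M.X p ⟶ F.obj (R.X p) := f.f p
  let ζ : Module.Dual k (∀ p, R.X p ⟶ M.X p) :=
    { toFun v := supertrace t hR fun p => v p ≫ f' p
      map_add' v w := by
        rw [← supertrace_add]
        simp
      map_smul' c v := by
        rw [RingHom.id_apply, smul_eq_mul, ← supertrace_smul]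
        simp }
  let δ : (∀ p, R.X p ⟶ M.X p) →ₗ[k] ∀ p, R.X p ⟶ M.X (p + 1) :=
    { toFun v p := v p ≫ M.d p (p + 1) - R.d p (p + 1) ≫ v (p + 1)
      map_add' v w := by
        ext p
        simp only [Pi.add_apply, Preadditive.add_comp, Preadditive.comp_add]
        abel
      map_smul' c v := by
        ext p
        simp [smul_sub] }
  obtain ⟨η, hη⟩ : ζ ∈ LinearMap.range δ.dualMap := by
    rw [LinearMap.range_dualMap_eq_dualAnnihilator_ker, Submodule.mem_dualAnnihilator]
    intro v hv
    refine hf { f := v, comm' := ?_ }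
    rintro i j rfl
    exact sub_eq_zero.1 (congrFun hv i)
  obtain ⟨S, hS⟩ := hR.exists_finset
  have h (p : ℤ) := t.exists_hom (hR.projective p)
    (η ∘ₗ LinearMap.single k (fun p => R.X p ⟶ M.X (p + 1)) p)
  choose h hh using h
  have key (q : ℤ) : koszulSign k (q + 1) • f' (q + 1) =
      M.d (q + 1) (q + 1 + 1) ≫ h (q + 1) - h q ≫ F.map (R.d q (q + 1)) := by
    -- The identity is tested on the family `v'` concentrated in degree `q + 1`, by computing `ζ v'`
    -- directly and through `η`.
    refine t.hom_ext (hR.projective (q + 1)) fun v => ?_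
    let v' : ∀ p, R.X p ⟶ M.X p := Pi.single (q + 1) v
    have hv : v' (q + 1) = v := by simp [v']
    have hv0 (p : ℤ) (hp : p ≠ q + 1) : v' p = 0 := by simp [v', Pi.single_eq_of_ne hp]
    have h₁ : ζ v' = koszulSign k (q + 1) *
        t.tr (R.X (q + 1)) (hR.projective (q + 1)) (v ≫ f' (q + 1)) := by
      change supertrace t hR _ = _
      rw [supertrace_eq_add t hR _ q fun p _ h₂ => by rw [hv0 p h₂, zero_comp], hv,
        hv0 q (by lia), koszulSign_succ, zero_comp, map_zero, zero_sub, mul_neg, neg_mul]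
    have hδq : δ v' q = - (R.d q (q + 1) ≫ v) := by
      simp [δ, hv, hv0 q (by lia)]
    have hδq' : δ v' (q + 1) = v ≫ M.d (q + 1) (q + 1 + 1) := by
      simp [δ, hv, hv0 (q + 1 + 1) (by lia)]
    have hδ0 (p : ℤ) (h₁ : p ≠ q) (h₂ : p ≠ q + 1) : δ v' p = 0 := by
      simp [δ, hv0 p h₂, hv0 (p + 1) (by lia)]
    have h₂ : ζ v' = t.tr _ (hR.projective (q + 1)) (v ≫ M.d (q + 1) (q + 1 + 1) ≫ h (q + 1)) -
        t.tr _ (hR.projective q) (R.d q (q + 1) ≫ v ≫ h q) := by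
      rw [← hη, LinearMap.dualMap_apply,
        Module.Dual.apply_eq_finsum S fun p hp => ⟨fun a b => (hS p hp).eq_of_src a b⟩,
        finsum_eq_sum_of_support_subset (s := {q, q + 1}), Finset.sum_pair (by lia), hδq, hδq',
        Pi.single_neg, map_neg]
      · have e₁ := hh q (R.d q (q + 1) ≫ v)
        have e₂ := hh (q + 1) (v ≫ M.d (q + 1) (q + 1 + 1))
        rw [Category.assoc] at e₁ e₂
        rw [e₁, e₂, add_comm, sub_eq_add_neg]
        rfl
      · intro p hp
        by_contra h
        simp only [Finset.coe_insert, Finset.coe_singleton, Set.mem_insert_iff,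
          Set.mem_singleton_iff, not_or] at h
        exact hp (by simp [hδ0 p h.1 h.2])
    rw [Linear.comp_smul, map_smul, smul_eq_mul, ← h₁, h₂, Preadditive.comp_sub, map_sub,
      ← t.tr_comp_map (hR.projective q) (hR.projective (q + 1)), Category.assoc]
  -- The sign turns the difference in `key` into the sum required of a homotopy.
  let s : ∀ i j, (ComplexShape.up ℤ).Rel j i →
      (M.X i ⟶ ((F.mapHomologicalComplex (ComplexShape.up ℤ)).obj R).X j) := fun i j hij =>
    koszulSign k j • ((M.XIsoOfEq (show i = j + 1 from hij.symm)).hom ≫ h j)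
  have hs (q : ℤ) : f.f (q + 1) = (Homotopy.nullHomotopicMap' s).f (q + 1) := by
    rw [Homotopy.nullHomotopicMap'_f (c := ComplexShape.up ℤ) (k₂ := q) (k₀ := q + 1 + 1) rfl rfl]
    have h₁ : f' (q + 1) = koszulSign k (q + 1) • koszulSign k (q + 1) • f' (q + 1) := by
      rw [smul_smul, koszulSign_mul_self, one_smul]
    rw [key, smul_sub] at h₁
    refine h₁.trans ?_
    change _ = M.d (q + 1) (q + 1 + 1) ≫ (koszulSign k (q + 1) • (𝟙 _ ≫ h (q + 1))) +
      (koszulSign k q • (𝟙 _ ≫ h q)) ≫ F.map (R.d q (q + 1))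
    simp only [Category.id_comp, Linear.comp_smul, Linear.smul_comp, Preadditive.comp_neg,
      koszulSign_succ, neg_smul, sub_neg_eq_add]
  have hs' : f = Homotopy.nullHomotopicMap' s := by
    ext p
    obtain ⟨q, rfl⟩ : ∃ r, p = r + 1 := ⟨p - 1, by lia⟩
    exact hs q
  rw [hs']
  exact ⟨Homotopy.nullHomotopy' s⟩

end Supertrace

/-! ### Traces on the bounded homotopy category -/

section DerivedTrace

open DerivedCategory

variable {k : Type*} [Field k] {C : Type*} [Category C] [Abelian C] [Linear k C]

/-- The class in `K^b(C)` of a chain map. -/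
def BoundedHomotopy.mk (k : Type*) [Field k] [Linear k C] (K L : BoundedHomotopy C) :
    (K.obj.as ⟶ L.obj.as) →ₗ[k] (K ⟶ L) where
  toFun f := ObjectProperty.homMk ((HomotopyCategory.quotient C (ComplexShape.up ℤ)).map f)
  map_add' f g := by
    apply ObjectProperty.hom_ext
    exact (HomotopyCategory.quotient C (ComplexShape.up ℤ)).map_add
  map_smul' c f := by
    apply ObjectProperty.hom_ext
    exact (HomotopyCategory.quotient C (ComplexShape.up ℤ)).map_smul c f

namespace BoundedHomotopy

variable {K L M : BoundedHomotopy C}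

theorem mk_surjective : Function.Surjective (mk k K L) := by
  intro f
  obtain ⟨g, hg⟩ := (HomotopyCategory.quotient C (ComplexShape.up ℤ)).map_surjective
    (X := K.obj.as) (Y := L.obj.as) f.hom
  exact ⟨g, ObjectProperty.hom_ext _ hg⟩

theorem mk_comp (f : K.obj.as ⟶ L.obj.as) (g : L.obj.as ⟶ M.obj.as) :
    mk k K M (f ≫ g) = mk k K L f ≫ mk k L M g := by
  apply ObjectProperty.hom_ext
  exact (HomotopyCategory.quotient C (ComplexShape.up ℤ)).map_comp f g

theorem mk_eq_zero_iff (f : K.obj.as ⟶ L.obj.as) :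
    mk k K L f = 0 ↔ Nonempty (Homotopy f 0) := by
  rw [← HomotopyCategory.quotient_map_eq_zero_iff]
  exact ⟨fun h => congrArg (fun φ => φ.hom) h, fun h => ObjectProperty.hom_ext _ h⟩

end BoundedHomotopy

/-- The bounded complexes of projective objects in `K^b(C)`. -/
def boundedProjectives (C : Type*) [Category C] [Abelian C] : ObjectProperty (BoundedHomotopy C) :=
  fun K => IsBoundedProjectiveComplex K.obj.as

variable {F : C ⥤ C} [F.Additive] (t : SerreTrace k F (isProjective C))

/-- The supertrace kills null-homotopic maps, so it descends to homotopy classes. -/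
theorem exists_boundedHomotopyTrace (K : BoundedHomotopy C) (hK : boundedProjectives C K) :
    ∃ τ : (K ⟶ (mapBoundedHomotopy F).obj K) →ₗ[k] k,
      ∀ u : K.obj.as ⟶ (F.mapHomologicalComplex (ComplexShape.up ℤ)).obj K.obj.as,
        τ (BoundedHomotopy.mk k K ((mapBoundedHomotopy F).obj K) u) = supertraceHom t hK u := by
  let q := BoundedHomotopy.mk k K ((mapBoundedHomotopy F).obj K)
  obtain ⟨τ, hτ⟩ : supertraceHom t hK ∈ LinearMap.range q.dualMap := by
    rw [LinearMap.range_dualMap_eq_dualAnnihilator_ker]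
    refine (Submodule.mem_dualAnnihilator _).2 fun u hu => ?_
    obtain ⟨h⟩ := (BoundedHomotopy.mk_eq_zero_iff (k := k) u).1 hu
    exact supertraceHom_eq_zero_of_homotopy t hK u h
  exact ⟨τ, fun u => LinearMap.congr_fun hτ u⟩

/-- The Serre trace on bounded complexes of projective objects given by the supertrace. -/
def SerreTrace.boundedHomotopy :
    SerreTrace k (mapBoundedHomotopy F) (boundedProjectives C) where
  tr K hK := (exists_boundedHomotopyTrace t K hK).choose
  tr_comp_map {K L} hK hL g u := by
    obtain ⟨g, rfl⟩ := BoundedHomotopy.mk_surjective (k := k) g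
    obtain ⟨u, rfl⟩ := BoundedHomotopy.mk_surjective (k := k) u
    refine (congrArg _ (BoundedHomotopy.mk_comp (k := k) u
      ((F.mapHomologicalComplex _).map g) (K := L) (L := (mapBoundedHomotopy F).obj K)
      (M := (mapBoundedHomotopy F).obj L)).symm).trans ?_
    refine ((exists_boundedHomotopyTrace t L hL).choose_spec _).trans ?_
    refine (supertraceHom_comp_map t hK hL g u).trans ?_
    refine ((exists_boundedHomotopyTrace t K hK).choose_spec _).symm.trans ?_
    exact congrArg _ (BoundedHomotopy.mk_comp (k := k) g u)
  bijective M K hK := by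
    have hτ := (exists_boundedHomotopyTrace t K hK).choose_spec
    set τ := (exists_boundedHomotopyTrace t K hK).choose
    constructor
    · intro h h' hh
      rw [← sub_eq_zero]
      obtain ⟨f, hf⟩ := BoundedHomotopy.mk_surjective (k := k) (h - h')
      rw [← hf, BoundedHomotopy.mk_eq_zero_iff]
      refine exists_homotopy_of_supertraceHom_eq_zero t hK f fun v => ?_
      refine (hτ _).symm.trans ((congrArg τ (BoundedHomotopy.mk_comp v f)).trans ?_)
      rw [hf, Preadditive.comp_sub, map_sub, sub_eq_zero]
      exact LinearMap.congr_fun hh _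
    · intro ξ
      obtain ⟨f, hf⟩ := exists_chainMap_supertraceHom_eq t hK (ξ ∘ₗ BoundedHomotopy.mk k K M)
        fun v hv => by
          rw [LinearMap.comp_apply, (BoundedHomotopy.mk_eq_zero_iff v).2 hv, map_zero]
      refine ⟨BoundedHomotopy.mk k M ((mapBoundedHomotopy F).obj K) f, LinearMap.ext fun v => ?_⟩
      obtain ⟨v, rfl⟩ := BoundedHomotopy.mk_surjective (k := k) v
      refine (congrArg τ (BoundedHomotopy.mk_comp v f).symm).trans ((hτ _).trans (hf v))

end DerivedTrace

/-- A Serre trace for `G` on the image of a functor `p` with a right adjoint `L` such that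
`𝟭 ≅ p ⋙ L` gives a Serre trace for `p ⋙ G ⋙ L`. -/
def SerreTrace.ofAdjunction {k : Type*} [Field k] {D K : Type*} [Category D] [Category K]
    [Preadditive D] [Preadditive K] [Linear k D] [Linear k K] {p : D ⥤ K} {L : K ⥤ D}
    [L.Additive] [L.Linear k] (adj : p ⊣ L) [∀ X, IsIso (adj.unit.app X)] {G : K ⥤ K}
    {P : ObjectProperty K} (t : SerreTrace k G P) (hp : ∀ X, P (p.obj X)) :
    SerreTrace k (p ⋙ G ⋙ L) ⊤ := by
  let e (X : D) (Z : K) : (p.obj X ⟶ Z) ≃ₗ[k] (X ⟶ L.obj Z) :=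
    { adj.homEquiv X Z with
      map_add' f g := by simp [Adjunction.homEquiv_unit]
      map_smul' c f := by simp [Adjunction.homEquiv_unit] }
  have he (X : D) (Z : K) (f : p.obj X ⟶ Z) : e X Z f = adj.homEquiv X Z f := rfl
  have he_comp {X Y : D} {Z : K} (g : X ⟶ Y) (h : Y ⟶ L.obj Z) :
      (e X Z).symm (g ≫ h) = p.map g ≫ (e Y Z).symm h := adj.homEquiv_naturality_left_symm g h
  refine
    { tr X _ := t.tr (p.obj X) (hp X) ∘ₗ (e X (G.obj (p.obj X))).symm.toLinearMap
      tr_comp_map {X Y} _ _ g u := ?_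
      bijective M X _ := ?_ }
  · have h₁ : (e Y _).symm (u ≫ L.map (G.map (p.map g))) =
      (e Y _).symm u ≫ G.map (p.map g) := adj.homEquiv_naturality_right_symm u _
    change t.tr (p.obj Y) (hp Y) ((e Y _).symm (u ≫ L.map (G.map (p.map g)))) =
      t.tr (p.obj X) (hp X) ((e X _).symm (g ≫ u))
    rw [h₁, t.tr_comp_map (hp X) (hp Y), he_comp]
  -- As the unit is invertible, `p` is fully faithful; `ρ` is the inverse of `p.map` and moves
  -- functionals between the two Hom spaces.
  · let ρ : (p.obj X ⟶ p.obj M) →ₗ[k] (X ⟶ M) :=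
      Linear.rightComp k X (inv (adj.unit.app M)) ∘ₗ (e X (p.obj M)).toLinearMap
    have hρ (v : p.obj X ⟶ p.obj M) : p.map (ρ v) = v := by
      apply (e X (p.obj M)).injective
      change adj.homEquiv X _ (p.map (adj.homEquiv X _ v ≫ inv (adj.unit.app M))) =
        adj.homEquiv X _ v
      simp [Adjunction.homEquiv_unit]
    have hρ' (g : X ⟶ M) : ρ (p.map g) = g := by
      change adj.homEquiv X _ (p.map g) ≫ inv (adj.unit.app M) = g
      simp [Adjunction.homEquiv_unit]
    constructor
    · intro h h' hh
      apply (e M _).symm.injective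
      refine t.hom_ext (hp X) fun v => ?_
      have := LinearMap.congr_fun hh (ρ v)
      change t.tr _ _ ((e X _).symm (ρ v ≫ h)) = t.tr _ _ ((e X _).symm (ρ v ≫ h')) at this
      rwa [he_comp, he_comp, hρ] at this
    · intro ξ
      obtain ⟨h, hh⟩ := t.exists_hom (hp X) (ξ ∘ₗ ρ)
      refine ⟨e M _ h, LinearMap.ext fun g => ?_⟩
      change t.tr _ _ ((e X _).symm (g ≫ e M _ h)) = _
      rw [he_comp, LinearEquiv.symm_apply_apply, hh, LinearMap.comp_apply, hρ']

/-! ### Serre duality for left derived functors -/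

section DerivedSerre

open DerivedCategory

variable {C : Type*} [Category C] [Abelian C] [HasDerivedCategory C] [EnoughProjectives C]
  {F H : C ⥤ C} [F.Additive] [H.Additive] {LF : Bounded C ⥤ Bounded C}

theorem nonempty_iso_of_comp_top {D E : Type*} [Category D] [Category E] {G G' : D ⥤ E}
    (e : (⊤ : ObjectProperty D).ι ⋙ G ≅ (⊤ : ObjectProperty D).ι ⋙ G') : Nonempty (G ≅ G') :=
  ⟨NatIso.ofComponents (fun X => e.app ⟨X, trivial⟩)
    (fun {X Y} f => e.hom.naturality (X := ⟨X, trivial⟩) (Y := ⟨Y, trivial⟩)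
      (ObjectProperty.homMk f))⟩

theorem IsBoundedLeftDerived.additive (hC : ∀ M : C, ∃ n, HasProjectiveDimensionLE M n)
    (h : IsBoundedLeftDerived F LF) : LF.Additive := by
  obtain ⟨e⟩ := h.nonempty_iso (isBoundedLeftDerived_projectiveResolutionFunctor hC F)
  have : (projectiveResolutionFunctor hC).Additive :=
    (projectiveResolutionAdjunction hC).left_adjoint_additive
  exact Functor.additive_of_iso e.symm

/-- On projectives in degree `0` the functor `LF` is `F` followed by the degree-`0` embedding, which
is itself fully faithful. -/
theorem IsBoundedLeftDerived.isFullyFaithful (hC : ∀ M : C, ∃ n, HasProjectiveDimensionLE M n)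
    (h : IsBoundedLeftDerived F LF) [LF.IsEquivalence] :
    ((isProjective C).ι ⋙ F).Full ∧ ((isProjective C).ι ⋙ F).Faithful := by
  obtain ⟨e⟩ := h.nonempty_iso_comp_boundedSingle hC
  have h₁ : (((isProjective C).ι ⋙ F) ⋙ boundedSingle C ⋙ boundedQh C).Full :=
    Functor.Full.of_iso e
  have h₂ : (((isProjective C).ι ⋙ F) ⋙ boundedSingle C ⋙ boundedQh C).Faithful :=
    Functor.Faithful.of_iso e
  exact ⟨Functor.Full.of_comp_faithful _ (boundedSingle C ⋙ boundedQh C),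
    Functor.Faithful.of_comp _ (boundedSingle C ⋙ boundedQh C)⟩

variable {k : Type*} [Field k] [Linear k C]

/-- The trace passes from projectives to bounded projective complexes by the supertrace, and from
there to the derived category through the resolution adjunction. -/
theorem IsBoundedLeftDerived.nonempty_serreTrace
    (hC : ∀ M : C, ∃ n, HasProjectiveDimensionLE M n)
    (h : IsBoundedLeftDerived F LF) (t : SerreTrace k F (isProjective C)) :
    Nonempty (SerreTrace k LF ⊤) := by
  obtain ⟨e⟩ := h.nonempty_iso (isBoundedLeftDerived_projectiveResolutionFunctor hC F)
  exact ⟨(t.boundedHomotopy.ofAdjunction (projectiveResolutionAdjunction hC)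
    (projectiveResolutionFunctor_obj hC)).ofIso (Functor.isoWhiskerLeft _ e)⟩

/-- If `LF` satisfies Serre duality, then `F` agrees on projective objects with any functor which
has a Serre trace on projective objects. -/
theorem IsBoundedLeftDerived.nonempty_iso_of_serreDuality
    (hC : ∀ M : C, ∃ n, HasProjectiveDimensionLE M n)
    (h : IsBoundedLeftDerived F LF) (d : SerreDuality k LF)
    (t : SerreTrace k H (isProjective C)) :
    Nonempty ((isProjective C).ι ⋙ F ≅ (isProjective C).ι ⋙ H) := by
  have hH := isBoundedLeftDerived_projectiveResolutionFunctor hC H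
  obtain ⟨t'⟩ := hH.nonempty_serreTrace hC t
  obtain ⟨e⟩ := d.toSerreTrace.nonempty_iso t'
  obtain ⟨e⟩ := nonempty_iso_of_comp_top e
  obtain ⟨eF⟩ := h.nonempty_iso_comp_boundedSingle hC
  obtain ⟨eH⟩ := hH.nonempty_iso_comp_boundedSingle hC
  let i : ((isProjective C).ι ⋙ F) ⋙ boundedSingle C ⋙ boundedQh C ≅
      ((isProjective C).ι ⋙ H) ⋙ boundedSingle C ⋙ boundedQh C :=
    eF.symm ≪≫ Functor.isoWhiskerLeft ((isProjective C).ι ⋙ boundedSingle C ⋙ boundedQh C) e ≪≫ eH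
  exact ⟨NatIso.ofComponents
    (fun P => (boundedSingle C ⋙ boundedQh C).preimageIso (i.app P)) (fun {P P'} f => by
      apply (boundedSingle C ⋙ boundedQh C).map_injective
      change (boundedSingle C ⋙ boundedQh C).map
          (F.map f.hom ≫ (boundedSingle C ⋙ boundedQh C).preimage (i.hom.app P')) =
        (boundedSingle C ⋙ boundedQh C).map
          ((boundedSingle C ⋙ boundedQh C).preimage (i.hom.app P) ≫ H.map f.hom)
      rw [Functor.map_comp, Functor.map_comp, Functor.map_preimage, Functor.map_preimage]
      exact i.hom.naturality f)⟩

end DerivedSerre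

/-! ### Morphisms of finitely generated modules -/

namespace FGModuleCat

section

variable {A : Type u} [Ring A]

/-- The morphism of `FGModuleCat` given by a linear map. -/
def homOf {M N : FGModuleCat.{u} A} (f : M.obj →ₗ[A] N.obj) : M ⟶ N :=
  ObjectProperty.homMk (ModuleCat.ofHom f)

theorem homOf_apply {M N : FGModuleCat.{u} A} (f : M.obj →ₗ[A] N.obj) (m : M.obj) :
    (homOf f).hom.hom m = f m := rfl

theorem comp_hom_apply {M N L : FGModuleCat.{u} A} (f : M ⟶ N) (g : N ⟶ L) (m : M.obj) :
    (f ≫ g).hom.hom m = g.hom.hom (f.hom.hom m) := rfl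

theorem hom_ext_apply {M N : FGModuleCat.{u} A} {f g : M ⟶ N}
    (h : ∀ m : M.obj, f.hom.hom m = g.hom.hom m) : f = g :=
  FGModuleCat.hom_ext (LinearMap.ext h)

/-- Evaluation of morphisms at an element. -/
def applyHom {M : FGModuleCat.{u} A} (N : FGModuleCat.{u} A) (m : M.obj) : (M ⟶ N) →+ N.obj where
  toFun f := f.hom.hom m
  map_zero' := rfl
  map_add' _ _ := rfl

theorem sum_apply' {M N : FGModuleCat.{u} A} {ι : Type*} (s : Finset ι) (f : ι → (M ⟶ N))
    (m : M.obj) : (∑ i ∈ s, f i).hom.hom m = ∑ i ∈ s, (f i).hom.hom m :=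
  map_sum (applyHom N m) f s

theorem smul_apply' {k : Type u} [Field k] [Algebra k A] {M N : FGModuleCat.{u} A} (c : k)
    (f : M ⟶ N) (m : M.obj) : (c • f).hom.hom m = c • f.hom.hom m := rfl

theorem mono_of_injective {M N : FGModuleCat.{u} A} (f : M ⟶ N)
    (hf : Function.Injective f.hom.hom) : Mono f where
  right_cancellation g h hgh := hom_ext_apply fun m =>
    hf (by rw [← comp_hom_apply, ← comp_hom_apply, hgh])

theorem epi_of_surjective {M N : FGModuleCat.{u} A} (f : M ⟶ N)
    (hf : Function.Surjective f.hom.hom) : Epi f where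
  left_cancellation g h hgh := hom_ext_apply fun m => by
    obtain ⟨m, rfl⟩ := hf m
    rw [← comp_hom_apply, ← comp_hom_apply, hgh]

theorem surjective_of_epi [IsNoetherianRing A] {M N : FGModuleCat.{u} A} (f : M ⟶ N) [Epi f] :
    Function.Surjective f.hom.hom := by
  have : Epi ((forget₂ (FGModuleCat A) (ModuleCat A)).map f) := inferInstance
  exact (ModuleCat.epi_iff_surjective _).1 this

/-- The regular module. -/
abbrev regular (A : Type u) [Ring A] : FGModuleCat.{u} A := FGModuleCat.of A A

/-- The morphism from the regular module given by an element. -/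
def ofElement {M : FGModuleCat.{u} A} (m : M.obj) : regular A ⟶ M :=
  homOf (LinearMap.toSpanSingleton A M.obj m)

theorem ofElement_apply {M : FGModuleCat.{u} A} (m : M.obj) (a : A) :
    (ofElement m).hom.hom a = a • m := rfl

instance [IsNoetherianRing A] : Projective (regular A) where
  factors {M N} f e _ := by
    obtain ⟨m, hm⟩ := surjective_of_epi e (f.hom.hom (1 : A))
    refine ⟨ofElement m, hom_ext_apply fun a => ?_⟩
    rw [comp_hom_apply, ofElement_apply, map_smul, hm, ← map_smul]
    exact congrArg _ (mul_one a)

theorem pi_map_eq_sum {n : ℕ} {M : Type*} [AddCommGroup M] [Module A M]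
    (f : (Fin n → A) →ₗ[A] M) (x : Fin n → A) : f x = ∑ i, x i • f (Pi.single i 1) := by
  conv_lhs => rw [← Finset.univ_sum_single x, map_sum]
  refine Finset.sum_congr rfl fun i _ => ?_
  rw [← map_smul, ← Pi.single_smul, smul_eq_mul, mul_one]

instance (n : ℕ) [IsNoetherianRing A] : Projective (FGModuleCat.of A (Fin n → A)) where
  factors {N L} f g _ := by
    let f' : (Fin n → A) →ₗ[A] L.obj := f.hom.hom
    choose m hm using fun i => surjective_of_epi g (f' (Pi.single i 1))
    refine ⟨homOf (M := FGModuleCat.of A (Fin n → A))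
      (Fintype.linearCombination A m), hom_ext_apply fun (x : Fin n → A) => ?_⟩
    change g.hom.hom (Fintype.linearCombination A m x) = f' x
    rw [Fintype.linearCombination_apply, pi_map_eq_sum f' x, map_sum]
    simp only [map_smul, hm]

theorem exists_epi_pi (M : FGModuleCat.{u} A) :
    ∃ (n : ℕ) (e : FGModuleCat.of A (Fin n → A) ⟶ M), Epi e := by
  obtain ⟨n, f, hf⟩ := Module.Finite.exists_fin' A M.obj
  exact ⟨n, homOf (M := FGModuleCat.of A (Fin n → A)) f, epi_of_surjective _ hf⟩

/-- A splitting of a finite free cover supplies the coordinates. -/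
theorem exists_dualBasis (P : FGModuleCat.{u} A) [Projective P] :
    ∃ (n : ℕ) (p : Fin n → P.obj) (f : Fin n → (P.obj →ₗ[A] A)),
      ∀ x, ∑ i, f i x • p i = x := by
  obtain ⟨n, e, _⟩ := exists_epi_pi P
  let s : P ⟶ FGModuleCat.of A (Fin n → A) := Projective.factorThru (𝟙 P) e
  let e' : (Fin n → A) →ₗ[A] P.obj := e.hom.hom
  let s' : P.obj →ₗ[A] (Fin n → A) := s.hom.hom
  refine ⟨n, fun i => e' (Pi.single i 1), fun i => LinearMap.proj i ∘ₗ s', fun x => ?_⟩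
  have h : e' (s' x) = x := by
    have h₁ := comp_hom_apply s e x
    rw [Projective.factorThru_comp] at h₁
    exact h₁.symm
  conv_rhs => rw [← h, pi_map_eq_sum e' (s' x)]
  rfl

instance [IsNoetherianRing A] : EnoughProjectives (FGModuleCat.{u} A) where
  presentation M := by
    obtain ⟨n, e, he⟩ := exists_epi_pi M
    exact ⟨{ p := _, f := e }⟩

end

end FGModuleCat

/-! ### The Serre trace of the Nakayama functor -/

section NakayamaTrace

variable (k A : Type u) [Field k] [Ring A] [Algebra k A]

section

variable {k A} {M : Type u} [AddCommGroup M] [Module k M] [Module A M]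

namespace AlgebraDual

theorem rightMul_add (φ : AlgebraDual k A) (a b : A) :
    φ.rightMul (a + b) = φ.rightMul a + φ.rightMul b := by
  ext x
  rw [rightMul_apply, add_mul, apply_add]
  rfl

theorem smul_rightMul (b : A) (φ : AlgebraDual k A) (a : A) :
    (b • φ).rightMul a = b • φ.rightMul a := by
  ext x
  rw [rightMul_apply, smul_apply, smul_apply, rightMul_apply, mul_assoc]

theorem rightMul_rightMul (φ : AlgebraDual k A) (a b : A) :
    (φ.rightMul a).rightMul b = φ.rightMul (a * b) := by
  ext x
  simp only [rightMul_apply, mul_assoc]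

/-- Evaluation at `1`. -/
def evalOne (k A : Type u) [Field k] [Ring A] [Algebra k A] : AlgebraDual k A →+ k where
  toFun φ := φ 1
  map_zero' := rfl
  map_add' _ _ := rfl

theorem smul_apply_one (a : A) (φ : AlgebraDual k A) : (a • φ) 1 = φ a := by
  rw [smul_apply, one_mul]

end AlgebraDual

/-- The map `φ ↦ φ ⊗ m`. -/
def nakayamaTmul (m : M) : AlgebraDual k A →ₗ[A] NakayamaModule k A M :=
  (nakayamaRelations k A M).mkQ ∘ₗ
    (TensorProduct.AlgebraTensorModule.mk k A (AlgebraDual k A) M).flip m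

theorem nakayamaTmul_smul (a : A) (φ : AlgebraDual k A) (m : M) :
    nakayamaTmul (a • m) φ = nakayamaTmul m (φ.rightMul a) :=
  ((Submodule.Quotient.eq (nakayamaRelations k A M)).2 (Submodule.subset_span
    (s := {t | ∃ (φ : AlgebraDual k A) (a : A) (m : M),
      t = φ.rightMul a ⊗ₜ[k] m - φ ⊗ₜ[k] (a • m)}) ⟨φ, a, m, rfl⟩)).symm

theorem nakayamaTmul_sum {ι : Type*} (s : Finset ι) (φ : AlgebraDual k A) (m : ι → M) :
    nakayamaTmul (∑ i ∈ s, m i) φ = ∑ i ∈ s, nakayamaTmul (m i) φ := by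
  simp [nakayamaTmul]

theorem nakayama_induction {p : NakayamaModule k A M → Prop} (x : NakayamaModule k A M)
    (zero : p 0) (tmul : ∀ m φ, p (nakayamaTmul m φ)) (add : ∀ x y, p x → p y → p (x + y)) :
    p x := by
  obtain ⟨x, rfl⟩ := Submodule.mkQ_surjective _ x
  induction x using TensorProduct.induction_on with
  | zero => simpa only [map_zero] using zero
  | tmul φ m => exact tmul m φ
  | add x y hx hy => simpa only [map_add] using add _ _ hx hy

variable [IsScalarTower k A M]
  {N : Type u} [AddCommGroup N] [Module k N] [Module A N] [IsScalarTower k A N]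

/-- The map `A^* ⊗_A M → A^*` induced by a linear form `f : M → A`. -/
def nakayamaCoord (f : M →ₗ[A] A) : NakayamaModule k A M →ₗ[A] AlgebraDual k A :=
  Submodule.liftQ _
    (TensorProduct.AlgebraTensorModule.lift
      { toFun φ :=
          { toFun m := φ.rightMul (f m)
            map_add' m m' := by rw [map_add, AlgebraDual.rightMul_add]
            map_smul' c m := by
              ext x
              have : f (c • m) = c • f m := (f.restrictScalars k).map_smul c m
              rw [AlgebraDual.rightMul_apply, this, smul_mul_assoc, AlgebraDual.apply_smul]
              rfl }
        map_add' φ ψ := rfl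
        map_smul' b φ := LinearMap.ext fun m => AlgebraDual.smul_rightMul b φ (f m) }) (by
    refine Submodule.span_le.2 ?_
    rintro _ ⟨φ, a, m, rfl⟩
    rw [SetLike.mem_coe, LinearMap.mem_ker, map_sub, sub_eq_zero]
    change (φ.rightMul a).rightMul (f m) = φ.rightMul (f (a • m))
    rw [AlgebraDual.rightMul_rightMul, map_smul, smul_eq_mul])

theorem nakayamaCoord_tmul (f : M →ₗ[A] A) (φ : AlgebraDual k A) (m : M) :
    nakayamaCoord f (nakayamaTmul m φ) = φ.rightMul (f m) := rfl

theorem nakayamaCoord_smul_one (f : M →ₗ[A] A) (a : A) (x : NakayamaModule k A M) :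
    nakayamaCoord f (a • x) 1 = nakayamaCoord f x a := by
  rw [map_smul, AlgebraDual.smul_apply_one]

theorem nakayamaCoord_sum_one {ι : Type*} (s : Finset ι) (f : M →ₗ[A] A)
    (x : ι → NakayamaModule k A M) :
    nakayamaCoord f (∑ i ∈ s, x i) 1 = ∑ i ∈ s, nakayamaCoord f (x i) 1 := by
  rw [map_sum]
  exact map_sum (AlgebraDual.evalOne k A) _ _

theorem nakayamaMap_tmul (g : M →ₗ[A] N) (φ : AlgebraDual k A) (m : M) :
    nakayamaMap k A g (nakayamaTmul m φ) = nakayamaTmul (g m) φ := rfl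

theorem nakayamaCoord_map (g : M →ₗ[A] N) (f : N →ₗ[A] A) (x : NakayamaModule k A M) :
    nakayamaCoord f (nakayamaMap k A g x) = nakayamaCoord (f ∘ₗ g) x := by
  induction x using nakayama_induction with
  | zero => simp only [map_zero]
  | tmul m φ => rfl
  | add x y hx hy => simp only [map_add, hx, hy]

variable {n : ℕ} {p : Fin n → M} {f : Fin n → (M →ₗ[A] A)}

/-- The dual basis expands `g` as `x ↦ ∑ f i x * g (p i)`, so the coordinates along the `f i`
determine every coordinate. -/
theorem nakayamaCoord_eq_sum (hp : ∀ x, ∑ i, f i x • p i = x) (g : M →ₗ[A] A) (x : NakayamaModule k A M) (b : A) :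
    nakayamaCoord g x b = ∑ i, nakayamaCoord (f i) x (g (p i) * b) := by
  induction x using nakayama_induction with
  | zero => simp only [map_zero, AlgebraDual.zero_apply, Finset.sum_const_zero]
  | tmul m φ =>
    simp only [nakayamaCoord_tmul, AlgebraDual.rightMul_apply]
    conv_lhs => rw [← hp m, map_sum, Finset.sum_mul]
    refine (map_sum (show A →ₗ[k] k from φ) _ _).trans (Finset.sum_congr rfl fun i _ => ?_)
    rw [map_smul, smul_eq_mul, mul_assoc]
    rfl
  | add x y hx hy => simp only [map_add, AlgebraDual.add_apply, hx, hy, Finset.sum_add_distrib]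

theorem nakayama_eq_sum (hp : ∀ x, ∑ i, f i x • p i = x) (x : NakayamaModule k A M) :
    x = ∑ i, nakayamaTmul (p i) (nakayamaCoord (f i) x) := by
  induction x using nakayama_induction with
  | zero => simp only [map_zero, Finset.sum_const_zero]
  | tmul m φ =>
    conv_lhs => rw [← hp m, nakayamaTmul_sum]
    refine Finset.sum_congr rfl fun i _ => ?_
    rw [nakayamaTmul_smul, nakayamaCoord_tmul]
  | add x y hx hy =>
    simp only [map_add, Finset.sum_add_distrib]
    rw [← hx, ← hy]

end

variable [Module.Finite k A]

open FGModuleCat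

instance : (nakayamaFunctor k A).Additive where
  map_add {M N f g} := hom_ext_apply fun x => by
    change nakayamaMap k A (f.hom.hom + g.hom.hom) x =
      nakayamaMap k A f.hom.hom x + nakayamaMap k A g.hom.hom x
    induction x using nakayama_induction with
    | zero => simp only [map_zero, add_zero]
    | tmul m φ =>
      simp only [nakayamaMap_tmul]
      rw [LinearMap.add_apply]
      simp only [nakayamaTmul, map_add]
      rfl
    | add x y hx hy =>
      simp only [map_add, hx, hy]
      abel

variable {k A}

/-- The trace form on `Hom(P, A^* ⊗_A P)` given by a dual basis of `P`. -/
def dualBasisTrace {P : FGModuleCat.{u} A} {n : ℕ} (p : Fin n → P.obj)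
    (f : Fin n → (P.obj →ₗ[A] A)) : (P ⟶ (nakayamaFunctor k A).obj P) →ₗ[k] k where
  toFun u := ∑ i, nakayamaCoord (k := k) (f i) (u.hom.hom (p i)) 1
  map_add' u v := by
    rw [← Finset.sum_add_distrib]
    refine Finset.sum_congr rfl fun i _ => ?_
    let x : NakayamaModule k A P.obj := u.hom.hom (p i)
    let y : NakayamaModule k A P.obj := v.hom.hom (p i)
    exact congrArg (AlgebraDual.evalOne k A) (map_add (nakayamaCoord (f i)) x y)
  map_smul' c u := by
    rw [RingHom.id_apply, smul_eq_mul, Finset.mul_sum]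
    refine Finset.sum_congr rfl fun i _ => ?_
    let x : NakayamaModule k A P.obj := u.hom.hom (p i)
    refine (nakayamaCoord_smul_one (f i) (algebraMap k A c) x).trans ?_
    rw [Algebra.algebraMap_eq_smul_one, AlgebraDual.apply_smul]

theorem dualBasisTrace_apply {P : FGModuleCat.{u} A} {n : ℕ} (p : Fin n → P.obj)
    (f : Fin n → (P.obj →ₗ[A] A)) (u : P ⟶ (nakayamaFunctor k A).obj P) :
    dualBasisTrace p f u = ∑ i, nakayamaCoord (k := k) (f i) (u.hom.hom (p i)) 1 := rfl

/-- Both sides expand to the same double sum over the two dual bases, and cyclicity is the exchange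
of the summations. With `g` the identity this also gives independence of the dual basis. -/
theorem dualBasisTrace_comp_map {P P' : FGModuleCat.{u} A} {n n' : ℕ} {p : Fin n → P.obj}
    {f : Fin n → (P.obj →ₗ[A] A)} (hp : ∀ x, ∑ i, f i x • p i = x) {p' : Fin n' → P'.obj}
    {f' : Fin n' → (P'.obj →ₗ[A] A)} (hp' : ∀ x, ∑ i, f' i x • p' i = x) (g : P ⟶ P')
    (u : P' ⟶ (nakayamaFunctor k A).obj P) :
    dualBasisTrace p' f' (u ≫ (nakayamaFunctor k A).map g) = dualBasisTrace p f (g ≫ u) := by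
  have h₁ (j : Fin n') : nakayamaCoord (k := k) (f' j)
      ((u ≫ (nakayamaFunctor k A).map g).hom.hom (p' j)) 1 =
      ∑ i, nakayamaCoord (k := k) (f i) (u.hom.hom (p' j)) (f' j (g.hom.hom (p i))) := by
    let x : NakayamaModule k A P.obj := u.hom.hom (p' j)
    refine (congrArg (AlgebraDual.evalOne k A)
      (nakayamaCoord_map g.hom.hom (f' j) x)).trans ?_
    refine (nakayamaCoord_eq_sum hp (f' j ∘ₗ g.hom.hom) x 1).trans ?_
    simp only [mul_one]
    rfl
  have h₂ (i : Fin n) : nakayamaCoord (k := k) (f i) ((g ≫ u).hom.hom (p i)) 1 =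
      ∑ j, nakayamaCoord (k := k) (f i) (u.hom.hom (p' j)) (f' j (g.hom.hom (p i))) := by
    let x (j : Fin n') : NakayamaModule k A P.obj := u.hom.hom (p' j)
    have h : (g ≫ u).hom.hom (p i) = ∑ j, f' j (g.hom.hom (p i)) • x j := by
      rw [comp_hom_apply]
      conv_lhs => rw [← hp' (g.hom.hom (p i)), map_sum]
      exact Finset.sum_congr rfl fun j _ => map_smul _ _ _
    refine (congrArg (fun y => nakayamaCoord (k := k) (f i) y 1) h).trans ?_
    refine (nakayamaCoord_sum_one _ _ _).trans (Finset.sum_congr rfl fun j _ => ?_)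
    exact nakayamaCoord_smul_one _ _ _
  rw [dualBasisTrace_apply, dualBasisTrace_apply]
  simp only [h₁, h₂]
  exact Finset.sum_comm

/-- The rank-one maps `x ↦ g x • m` span `Hom(P, M)`, and the trace of such a map followed by `h` is
the `g`-coordinate of `h m` at `1`. So the pairing records exactly the coordinates of `h`. -/
theorem dualBasisTrace_bijective {P : FGModuleCat.{u} A} {n : ℕ} {p : Fin n → P.obj}
    {f : Fin n → (P.obj →ₗ[A] A)} (hp : ∀ x, ∑ i, f i x • p i = x) (M : FGModuleCat.{u} A) :
    Function.Bijective fun h : M ⟶ (nakayamaFunctor k A).obj P =>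
      (dualBasisTrace p f ∘ₗ Linear.rightComp k P h : Module.Dual k (P ⟶ M)) := by
  let r (g : P.obj →ₗ[A] A) (m : M.obj) : P ⟶ M := homOf (g.smulRight m)
  have hr (g : P.obj →ₗ[A] A) (m : M.obj) (h : M ⟶ (nakayamaFunctor k A).obj P) :
      dualBasisTrace p f (r g m ≫ h) = nakayamaCoord (k := k) g (h.hom.hom m) 1 := by
    rw [dualBasisTrace_apply]
    let x : NakayamaModule k A P.obj := h.hom.hom m
    refine Eq.trans (Finset.sum_congr rfl fun i _ => ?_) (nakayamaCoord_eq_sum hp g x 1).symm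
    have : (r g m ≫ h).hom.hom (p i) = g (p i) • x := h.hom.hom.map_smul _ _
    refine (congrArg (fun y => nakayamaCoord (k := k) (f i) y 1) this).trans ?_
    rw [mul_one]
    exact nakayamaCoord_smul_one _ _ _
  constructor
  · intro h h' hh
    refine hom_ext_apply fun m => ?_
    have key (g : P.obj →ₗ[A] A) : nakayamaCoord (k := k) g (h.hom.hom m) =
        nakayamaCoord (k := k) g (h'.hom.hom m) := by
      ext b
      -- Replacing `m` by `b • m` moves the evaluation point of the coordinate from `1` to `b`.
      have h₁ := LinearMap.congr_fun hh (r g (b • m))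
      change dualBasisTrace p f (r g (b • m) ≫ h) = dualBasisTrace p f (r g (b • m) ≫ h') at h₁
      rw [hr, hr, map_smul, map_smul] at h₁
      exact ((nakayamaCoord_smul_one _ _ _).symm.trans h₁).trans (nakayamaCoord_smul_one _ _ _)
    refine (nakayama_eq_sum hp (h.hom.hom m)).trans
      (Eq.trans ?_ (nakayama_eq_sum hp (h'.hom.hom m)).symm)
    exact Finset.sum_congr rfl fun i _ => congrArg _ (key (f i))
  · intro ξ
    have hr_add (g : P.obj →ₗ[A] A) (m m' : M.obj) : r g (m + m') = r g m + r g m' :=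
      hom_ext_apply fun x => smul_add _ _ _
    -- `ψ i m` supplies the coefficient of `p i` in the sought element `h m`, as dictated by the
    -- values of `ξ` on rank-one maps.
    let ψ (i : Fin n) : M.obj →ₗ[A] AlgebraDual k A :=
      { toFun m := show A →ₗ[k] k from
          { toFun a := ξ (r (f i) (a • m))
            map_add' a b := by rw [add_smul, hr_add, map_add]
            map_smul' c a := by
              rw [RingHom.id_apply, ← map_smul]
              congr 1
              refine hom_ext_apply fun x => ?_
              rw [smul_apply']
              change f i x • (c • a) • m = algebraMap k A c • f i x • a • m
              simp only [smul_smul, Algebra.algebraMap_eq_smul_one, smul_mul_assoc,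
                mul_smul_comm, one_mul] }
        map_add' m m' := by
          ext a
          change ξ (r (f i) (a • (m + m'))) = ξ (r (f i) (a • m)) + ξ (r (f i) (a • m'))
          rw [smul_add, hr_add, map_add]
        map_smul' b m := by
          ext a
          change ξ (r (f i) (a • b • m)) = ξ (r (f i) ((a * b) • m))
          rw [smul_smul] }
    let h : M ⟶ (nakayamaFunctor k A).obj P := homOf (∑ j, nakayamaTmul (p j) ∘ₗ ψ j)
    have hh (g : P.obj →ₗ[A] A) (m : M.obj) :
        nakayamaCoord (k := k) g (h.hom.hom m) 1 = ξ (r g m) := by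
      have h₁ : h.hom.hom m = ∑ j, nakayamaTmul (p j) (ψ j m) := by
        simp only [h, homOf_apply, LinearMap.sum_apply]
        rfl
      have h₂ : r g m = ∑ j, r (f j) (g (p j) • m) := by
        refine hom_ext_apply fun x => ?_
        rw [sum_apply']
        change g x • m = ∑ j, f j x • g (p j) • m
        simp only [smul_smul, ← Finset.sum_smul, ← smul_eq_mul, ← map_smul, ← map_sum, hp]
      rw [h₂, map_sum]
      refine (congrArg (fun y => nakayamaCoord (k := k) g y 1) h₁).trans ?_
      refine (nakayamaCoord_sum_one _ _ _).trans (Finset.sum_congr rfl fun j _ => ?_)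
      rw [nakayamaCoord_tmul, AlgebraDual.rightMul_apply, mul_one]
      rfl
    refine ⟨h, LinearMap.ext fun t => ?_⟩
    have ht : t = ∑ i, r (f i) (t.hom.hom (p i)) := by
      refine hom_ext_apply fun x => ?_
      rw [sum_apply']
      conv_lhs => rw [← hp x, map_sum]
      exact Finset.sum_congr rfl fun i _ => map_smul _ _ _
    change dualBasisTrace p f (t ≫ h) = ξ t
    conv_rhs => rw [ht, map_sum]
    rw [dualBasisTrace_apply]
    exact Finset.sum_congr rfl fun i _ => hh (f i) (t.hom.hom (p i))

variable (k A) in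
/-- The Serre trace of the Nakayama functor on projective modules. -/
def nakayamaTrace : SerreTrace k (nakayamaFunctor k A) (isProjective (FGModuleCat.{u} A)) where
  tr P hP :=
    haveI : Projective P := hP
    dualBasisTrace (exists_dualBasis P).choose_spec.choose
      (exists_dualBasis P).choose_spec.choose_spec.choose
  tr_comp_map {P P'} hP hP' g u := by
    have : Projective P := hP
    have : Projective P' := hP'
    exact dualBasisTrace_comp_map (exists_dualBasis P).choose_spec.choose_spec.choose_spec
      (exists_dualBasis P').choose_spec.choose_spec.choose_spec g u
  bijective M P hP := by
    have : Projective P := hP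
    exact dualBasisTrace_bijective (exists_dualBasis P).choose_spec.choose_spec.choose_spec M

end NakayamaTrace

/-! ### Summands of powers and density of an object -/

section Retracts

variable {C : Type*} [Category C] [Preadditive C]

/-- The identity of `J` is a finite sum of morphisms that factor through `K`. -/
def IsRetractOfSum (K J : C) : Prop :=
  ∃ (ι : Type) (_ : Fintype ι) (i : ι → (J ⟶ K)) (r : ι → (K ⟶ J)), ∑ s, i s ≫ r s = 𝟙 J

namespace IsRetractOfSum

variable {K J : C}

theorem of_isZero (h : IsZero J) : IsRetractOfSum K J :=
  ⟨Empty, inferInstance, Empty.elim, Empty.elim, h.eq_of_src _ _⟩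

theorem of_retract (i : J ⟶ K) (r : K ⟶ J) (h : i ≫ r = 𝟙 J) : IsRetractOfSum K J :=
  ⟨Unit, inferInstance, fun _ => i, fun _ => r, by simpa using h⟩

theorem of_sum {Y Z : C} (hY : IsRetractOfSum K Y) (hZ : IsRetractOfSum K Z) (i : J ⟶ Y)
    (r : Y ⟶ J) (i' : J ⟶ Z) (r' : Z ⟶ J) (h : i ≫ r + i' ≫ r' = 𝟙 J) :
    IsRetractOfSum K J := by
  obtain ⟨ι, _, iY, rY, hY⟩ := hY
  obtain ⟨κ, _, iZ, rZ, hZ⟩ := hZ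
  refine ⟨ι ⊕ κ, inferInstance, Sum.elim (fun s => i ≫ iY s) (fun s => i' ≫ iZ s),
    Sum.elim (fun s => rY s ≫ r) (fun s => rZ s ≫ r'), ?_⟩
  have h₁ : ∑ s, (i ≫ iY s) ≫ rY s ≫ r = i ≫ (∑ s, iY s ≫ rY s) ≫ r := by
    simp only [Preadditive.comp_sum, Preadditive.sum_comp, Category.assoc]
  have h₂ : ∑ s, (i' ≫ iZ s) ≫ rZ s ≫ r' = i' ≫ (∑ s, iZ s ≫ rZ s) ≫ r' := by
    simp only [Preadditive.comp_sum, Preadditive.sum_comp, Category.assoc]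
  rw [Fintype.sum_sum_type]
  simp only [Sum.elim_inl, Sum.elim_inr]
  rw [h₁, h₂, hY, hZ, Category.id_comp, Category.id_comp, h]

theorem exists_ne_zero_of_hom (h : IsRetractOfSum K J) {S : C} {f : S ⟶ J} (hf : f ≠ 0) :
    ∃ g : S ⟶ K, g ≠ 0 := by
  obtain ⟨ι, _, i, r, h⟩ := h
  by_contra! H
  apply hf
  rw [← Category.comp_id f, ← h, Preadditive.comp_sum]
  exact Finset.sum_eq_zero fun s _ => by rw [← Category.assoc, H (f ≫ i s), zero_comp]

theorem exists_ne_zero_of_hom' (h : IsRetractOfSum K J) {S : C} {f : J ⟶ S} (hf : f ≠ 0) :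
    ∃ g : K ⟶ S, g ≠ 0 := by
  obtain ⟨ι, _, i, r, h⟩ := h
  by_contra! H
  apply hf
  rw [← Category.id_comp f, ← h, Preadditive.sum_comp]
  exact Finset.sum_eq_zero fun s _ => by rw [Category.assoc, H (r s ≫ f), comp_zero]

theorem projective_of_sum_eq_id {ι : Type*} [Fintype ι] {K : ι → C} (hK : ∀ s, Projective (K s))
    (i : ∀ s, J ⟶ K s) (r : ∀ s, K s ⟶ J) (h : ∑ s, i s ≫ r s = 𝟙 J) : Projective J where
  factors f e _ := by
    refine ⟨∑ s, i s ≫ Projective.factorThru (r s ≫ f) e, ?_⟩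
    conv_rhs => rw [← Category.id_comp f, ← h, Preadditive.sum_comp]
    simp only [Preadditive.sum_comp, Category.assoc, Projective.factorThru_comp]

theorem injective_of_sum_eq_id {ι : Type*} [Fintype ι] {K : ι → C} (hK : ∀ s, Injective (K s))
    (i : ∀ s, J ⟶ K s) (r : ∀ s, K s ⟶ J) (h : ∑ s, i s ≫ r s = 𝟙 J) : Injective J where
  factors f e _ := by
    refine ⟨∑ s, Injective.factorThru (f ≫ i s) e ≫ r s, ?_⟩
    conv_rhs => rw [← Category.comp_id f, ← h, Preadditive.comp_sum]
    simp only [Preadditive.comp_sum, Injective.comp_factorThru_assoc, Category.assoc]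

theorem projective (h : IsRetractOfSum K J) (hK : Projective K) : Projective J := by
  obtain ⟨ι, _, i, r, h⟩ := h
  exact projective_of_sum_eq_id (fun _ => hK) i r h

theorem injective (h : IsRetractOfSum K J) (hK : Injective K) : Injective J := by
  obtain ⟨ι, _, i, r, h⟩ := h
  exact injective_of_sum_eq_id (fun _ => hK) i r h

end IsRetractOfSum

/-- The functor `Hom(V, -)` to right `End V`-modules is fully faithful on `Hom(J, J')`. -/
structure IsDenseOn (V J J' : C) : Prop where
  ext {g g' : J ⟶ J'} (h : ∀ v : V ⟶ J, v ≫ g = v ≫ g') : g = g'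
  exists_hom (θ : (V ⟶ J) →+ (V ⟶ J')) (hθ : ∀ (e : V ⟶ V) (v : V ⟶ J), θ (e ≫ v) = e ≫ θ v) :
    ∃ g : J ⟶ J', ∀ v, θ v = v ≫ g

namespace IsDenseOn

variable {V E J J' : C}

/-- A morphism `J ⟶ J'` is a matrix of endomorphisms of `E`, with entries `r s ≫ g ≫ i' t`; density
is applied entry by entry. -/
theorem of_isRetractOfSum (h : IsDenseOn V E E) (hJ : IsRetractOfSum E J)
    (hJ' : IsRetractOfSum E J') : IsDenseOn V J J' := by
  obtain ⟨ι, _, i, r, hJ⟩ := hJ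
  obtain ⟨κ, _, i', r', hJ'⟩ := hJ'
  constructor
  · intro g g' H
    have key (s : ι) (t : κ) : r s ≫ g ≫ i' t = r s ≫ g' ≫ i' t := h.ext fun v => by
      simpa only [Category.assoc] using congrArg (· ≫ i' t) (H (v ≫ r s))
    rw [← Category.comp_id g, ← Category.comp_id g', ← hJ', ← Category.id_comp (g ≫ _),
      ← Category.id_comp (g' ≫ _), ← hJ]
    simp only [Preadditive.comp_sum, Preadditive.sum_comp, Category.assoc]
    refine Finset.sum_congr rfl fun t _ => Finset.sum_congr rfl fun s _ => ?_
    have := congrArg (fun x => i s ≫ x ≫ r' t) (key s t)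
    simpa only [Category.assoc] using this
  · intro θ hθ
    have key (s : ι) (t : κ) := h.exists_hom
      ((Preadditive.rightComp V (i' t)).comp (θ.comp (Preadditive.rightComp V (r s))))
      (fun e v => by
        change θ ((e ≫ v) ≫ r s) ≫ i' t = e ≫ θ (v ≫ r s) ≫ i' t
        rw [Category.assoc, hθ, Category.assoc])
    choose g hg using key
    refine ⟨∑ t, ∑ s, i s ≫ g s t ≫ r' t, fun v => ?_⟩
    rw [← Category.comp_id (θ v), ← hJ', Preadditive.comp_sum, Preadditive.comp_sum]
    refine Finset.sum_congr rfl fun t _ => ?_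
    conv_lhs => rw [← Category.comp_id v, ← hJ, Preadditive.comp_sum, map_sum,
      Preadditive.sum_comp]
    rw [Preadditive.comp_sum]
    refine Finset.sum_congr rfl fun s _ => ?_
    have := congrArg (· ≫ r' t) (hg s t (v ≫ i s))
    change (θ ((v ≫ i s) ≫ r s) ≫ i' t) ≫ r' t = ((v ≫ i s) ≫ g s t) ≫ r' t at this
    simpa only [Category.assoc] using this

/-- A compatible `θ` on maps from `W` induces one on maps from `V`, which density at `V` realises by
some `g`. That `g` also realises `θ` is checked after precomposing with maps `V ⟶ W`. -/
theorem of_isRetractOfSum_left {W : C} (h : IsDenseOn V J J') (hW : IsDenseOn V W J')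
    (hV : IsRetractOfSum W V) : IsDenseOn W J J' := by
  obtain ⟨ι, _, i, r, hV⟩ := hV
  have expand {Z : C} (v : V ⟶ Z) : v = ∑ s, i s ≫ r s ≫ v := by
    conv_lhs => rw [← Category.id_comp v, ← hV, Preadditive.sum_comp]
    simp only [Category.assoc]
  constructor
  · intro g g' H
    refine h.ext fun v => ?_
    rw [expand (v ≫ g), expand (v ≫ g')]
    refine Finset.sum_congr rfl fun s _ => ?_
    rw [← Category.assoc (r s), H, Category.assoc]
  · intro θ hθ
    let θ' : (V ⟶ J) →+ (V ⟶ J') :=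
      ∑ s, (Preadditive.leftComp J' (i s)).comp (θ.comp (Preadditive.leftComp J (r s)))
    have hθ' (v : V ⟶ J) : θ' v = ∑ s, i s ≫ θ (r s ≫ v) := by
      simp only [θ', AddMonoidHom.finsetSum_apply]
      rfl
    have key (x : V ⟶ W) (w : W ⟶ J) : θ' (x ≫ w) = x ≫ θ w := by
      rw [hθ', expand (x ≫ θ w)]
      refine Finset.sum_congr rfl fun s _ => ?_
      rw [← Category.assoc (r s), hθ, Category.assoc]
    obtain ⟨g, hg⟩ := h.exists_hom θ' (fun e v => by
      rw [expand v, Preadditive.comp_sum, map_sum, map_sum, Preadditive.comp_sum]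
      refine Finset.sum_congr rfl fun s _ => ?_
      rw [← Category.assoc, key, key, Category.assoc])
    refine ⟨g, fun w => hW.ext fun x => ?_⟩
    rw [← key, hg, Category.assoc]

end IsDenseOn

/-- Full faithfulness and `φ` identify `Hom(G' q, G p)` with `Hom(q, p)` and then with `Hom(G' q, G'
p)`, compatibly with endomorphisms of `q`. Density converts these identifications into mutually
inverse natural morphisms. -/
theorem nonempty_iso_of_isDenseOn {D : Type*} [Category D] [Preadditive D] (G G' : D ⥤ C)
    [G.Additive] [G'.Additive] [G.Full] [G.Faithful] [G'.Full] [G'.Faithful] (q : D)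
    (φ : G.obj q ≅ G'.obj q) (hφ : ∀ x : q ⟶ q, G.map x ≫ φ.hom = φ.hom ≫ G'.map x)
    (I : C → Prop) (hG : ∀ p, I (G.obj p)) (hG' : ∀ p, I (G'.obj p))
    (hI : ∀ J J', I J → I J' → IsDenseOn (G'.obj q) J J') : Nonempty (G ≅ G') := by
  have hφ' (x : q ⟶ q) : φ.inv ≫ G.map x = G'.map x ≫ φ.inv := by
    rw [Iso.inv_comp_eq, ← Category.assoc, ← hφ, Category.assoc, Iso.hom_inv_id,
      Category.comp_id]
  let Φ (p : D) : (G'.obj q ⟶ G.obj p) →+ (G'.obj q ⟶ G'.obj p) :=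
    { toFun w := G'.map (G.preimage (φ.hom ≫ w))
      map_zero' := by
        rw [← G'.map_zero q p]
        exact congrArg _ (G.map_injective (by simp))
      map_add' w w' := by
        rw [← G'.map_add]
        exact congrArg _ (G.map_injective (by simp)) }
  let Ψ (p : D) : (G'.obj q ⟶ G'.obj p) →+ (G'.obj q ⟶ G.obj p) :=
    { toFun w := φ.inv ≫ G.map (G'.preimage w)
      map_zero' := by
        rw [show G'.preimage (0 : G'.obj q ⟶ G'.obj p) = 0 from G'.map_injective (by simp)]
        simp
      map_add' w w' := by
        rw [← Preadditive.comp_add, ← G.map_add]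
        exact congrArg (fun x => φ.inv ≫ G.map x) (G'.map_injective (by simp)) }
  have hΦ (p : D) := (hI _ _ (hG p) (hG' p)).exists_hom (Φ p) (fun e v => by
    obtain ⟨x, rfl⟩ := G'.map_surjective e
    change G'.map _ = G'.map x ≫ G'.map _
    rw [← G'.map_comp]
    refine congrArg _ (G.map_injective ?_)
    rw [G.map_preimage, G.map_comp, G.map_preimage, ← Category.assoc, ← Category.assoc, hφ])
  have hΨ (p : D) := (hI _ _ (hG' p) (hG p)).exists_hom (Ψ p) (fun e v => by
    obtain ⟨x, rfl⟩ := G'.map_surjective e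
    change φ.inv ≫ G.map _ = G'.map x ≫ φ.inv ≫ G.map _
    rw [← Category.assoc, ← hφ', Category.assoc, ← G.map_comp]
    refine congrArg (fun x => φ.inv ≫ G.map x) (G'.map_injective ?_)
    rw [G'.map_preimage, G'.map_comp, G'.map_preimage])
  choose g hg using hΦ
  choose g' hg' using hΨ
  refine ⟨NatIso.ofComponents (fun p =>
    { hom := g p
      inv := g' p
      hom_inv_id := (hI _ _ (hG p) (hG p)).ext fun w => ?_
      inv_hom_id := (hI _ _ (hG' p) (hG' p)).ext fun w => ?_ }) (fun {p p'} f =>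
        (hI _ _ (hG p) (hG' p')).ext fun w => ?_)⟩
  · rw [← Category.assoc, ← hg, ← hg', Category.comp_id]
    change φ.inv ≫ G.map (G'.preimage (G'.map (G.preimage (φ.hom ≫ w)))) = w
    simp
  · rw [← Category.assoc, ← hg', ← hg, Category.comp_id]
    change G'.map (G.preimage (φ.hom ≫ φ.inv ≫ G.map (G'.preimage w))) = w
    simp
  · rw [← Category.assoc, ← Category.assoc, ← hg, ← hg]
    change G'.map _ = G'.map _ ≫ G'.map f
    rw [← G'.map_comp]
    exact congrArg _ (G.map_injective (by simp))

end Retracts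

/-! ### Simple modules, socles and heads -/

section Good

variable {A : Type u} [Ring A] {M S : Type u} [AddCommGroup M] [Module A M]
  [AddCommGroup S] [Module A S]

theorem isSemisimpleModule_moduleSocle : IsSemisimpleModule A (moduleSocle A M) := by
  have h : moduleSocle A M = ⨆ N ∈ {N : Submodule A M | IsSimpleModule A N}, N := sSup_eq_iSup
  rw [h]
  refine isSemisimpleModule_biSup_of_isSemisimpleModule_submodule fun N hN => ?_
  have : IsSimpleModule A N := hN
  infer_instance

theorem isSemisimpleModule_moduleHead [IsArtinian A M] :
    IsSemisimpleModule A (ModuleHead A M) :=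
  (IsArtinian.isSemisimpleModule_iff_jacobson A _).2 (Module.jacobson_quotient_jacobson A M)

theorem exists_injective_moduleSocle [IsSimpleModule A S] {f : S →ₗ[A] M} (hf : f ≠ 0) :
    ∃ g : S →ₗ[A] moduleSocle A M, Function.Injective g := by
  have hinj := (LinearMap.injective_or_eq_zero f).resolve_right hf
  have hS : IsSimpleModule A (LinearMap.range f) :=
    IsSimpleModule.congr (LinearEquiv.ofInjective f hinj).symm
  have hle : LinearMap.range f ≤ moduleSocle A M := le_sSup hS
  exact ⟨f.codRestrict _ fun x => hle ⟨x, rfl⟩, fun x y hxy => hinj (congrArg Subtype.val hxy)⟩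

theorem exists_surjective_moduleHead [IsSimpleModule A S] {f : M →ₗ[A] S} (hf : f ≠ 0) :
    ∃ g : ModuleHead A M →ₗ[A] S, Function.Surjective g := by
  have hsurj := (LinearMap.surjective_or_eq_zero f).resolve_right hf
  have hle : Module.jacobson A M ≤ LinearMap.ker f := by
    have h := Module.map_jacobson_le f
    rw [IsSemisimpleModule.jacobson_eq_bot A S, Submodule.map_le_iff_le_comap] at h
    exact h
  refine ⟨(Module.jacobson A M).liftQ f hle, fun y => ?_⟩
  obtain ⟨x, rfl⟩ := hsurj y
  exact ⟨Submodule.Quotient.mk x, rfl⟩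

/-- A simple module is in the socle of a good module if and only if it is in its head. -/
theorem IsGoodModule.exists_ne_zero_iff [IsArtinian A M] (h : IsGoodModule A M)
    [IsSimpleModule A S] : (∃ f : S →ₗ[A] M, f ≠ 0) ↔ ∃ f : M →ₗ[A] S, f ≠ 0 := by
  obtain ⟨e⟩ := h
  have := isSemisimpleModule_moduleSocle (A := A) (M := M)
  have := isSemisimpleModule_moduleHead (A := A) (M := M)
  have := IsSimpleModule.nontrivial A S
  obtain ⟨s, hs⟩ := exists_ne (0 : S)
  constructor
  · rintro ⟨f, hf⟩
    obtain ⟨g, hg⟩ := exists_injective_moduleSocle hf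
    -- The simple module sits in the socle, hence in the isomorphic semisimple head, of which it is
    -- therefore also a quotient.
    obtain ⟨r, hr⟩ := IsSemisimpleModule.extension_property (e.toLinearMap ∘ₗ g)
      (e.injective.comp hg) LinearMap.id
    obtain ⟨m, hm⟩ := Submodule.mkQ_surjective (Module.jacobson A M) (e (g s))
    refine ⟨r ∘ₗ (Module.jacobson A M).mkQ, fun h0 => hs ?_⟩
    have h₁ : r (e (g s)) = s := LinearMap.congr_fun hr s
    rw [← h₁, ← hm]
    exact LinearMap.congr_fun h0 m
  · rintro ⟨f, hf⟩
    obtain ⟨g, hg⟩ := exists_surjective_moduleHead hf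
    obtain ⟨r, hr⟩ := IsSemisimpleModule.lifting_property (g ∘ₗ e.toLinearMap)
      (hg.comp e.surjective) LinearMap.id
    refine ⟨(moduleSocle A M).subtype ∘ₗ r, fun h0 => hs ?_⟩
    have h₁ : g (e (r s)) = s := LinearMap.congr_fun hr s
    have h₂ : r s = 0 := Subtype.ext (LinearMap.congr_fun h0 s)
    rw [← h₁, h₂, map_zero, map_zero]

end Good

/-! ### Injective modules as summands of powers, detected on simple submodules -/

namespace FGModuleCat

section

variable {A : Type u} [Ring A]

theorem injective_of_mono {M N : FGModuleCat.{u} A} (f : M ⟶ N) [Mono f] :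
    Function.Injective f.hom.hom := by
  intro x y hxy
  have h : ofElement x ≫ f = ofElement y ≫ f := hom_ext_apply fun a => by
    rw [comp_hom_apply, comp_hom_apply, ofElement_apply, ofElement_apply, map_smul, map_smul, hxy]
  have h' := congrArg (fun g : regular A ⟶ M => g.hom.hom (1 : A)) ((cancel_mono f).1 h)
  exact ((one_smul A x).symm.trans h').trans (one_smul A y)

theorem eq_zero_of_apply_eq_zero {M N : FGModuleCat.{u} A} {f : M ⟶ N}
    (h : ∀ m : M.obj, f.hom.hom m = 0) : f = 0 := hom_ext_apply h

theorem exists_homOf_ne_zero_iff {M N : FGModuleCat.{u} A} :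
    (∃ f : M.obj →ₗ[A] N.obj, f ≠ 0) ↔ ∃ f : M ⟶ N, f ≠ 0 := by
  constructor
  · rintro ⟨f, hf⟩
    exact ⟨homOf f, fun h => hf (congrArg (fun g : M ⟶ N => g.hom.hom) h)⟩
  · rintro ⟨f, hf⟩
    exact ⟨f.hom.hom, fun h => hf (eq_zero_of_apply_eq_zero fun m => LinearMap.congr_fun h m)⟩

/-- The maps assemble into a monomorphism `I ⟶ W^n`, which splits because `I` is injective. -/
theorem isRetractOfSum_of_jointly_injective {I W : FGModuleCat.{u} A} [Injective I] {n : ℕ}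
    (i : Fin n → (I ⟶ W)) (h : ∀ m : I.obj, (∀ j, (i j).hom.hom m = 0) → m = 0) :
    IsRetractOfSum W I := by
  let i' : I ⟶ FGModuleCat.of A (Fin n → W.obj) :=
    homOf (N := FGModuleCat.of A (Fin n → W.obj)) (LinearMap.pi fun j => (i j).hom.hom)
  have : Mono i' := mono_of_injective _ ((injective_iff_map_eq_zero _).2
    fun m hm => h m fun j => congrFun hm j)
  let r := Injective.factorThru (𝟙 I) i'
  refine ⟨Fin n, inferInstance, i, fun j =>
    homOf (r.hom.hom ∘ₗ LinearMap.single A (fun _ => W.obj) j), hom_ext_apply fun m => ?_⟩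
  let y : Fin n → W.obj := i'.hom.hom m
  have h₁ : r.hom.hom y = m := by
    refine (comp_hom_apply i' r m).symm.trans ?_
    rw [Injective.comp_factorThru]
    rfl
  rw [sum_apply']
  refine Eq.trans ?_ h₁
  have h₂ : y = ∑ j, Pi.single j (y j) := (Finset.univ_sum_single y).symm
  rw [h₂]
  exact (map_sum r.hom.hom _ _).symm

end

section

variable (k : Type u) {A : Type u} [Field k] [Ring A] [Algebra k A] [Module.Finite k A]

theorem finite_obj (M : FGModuleCat.{u} A) : Module.Finite k M.obj :=
  Module.Finite.trans A M.obj

theorem finite_hom (M N : FGModuleCat.{u} A) : Module.Finite k (M ⟶ N) := by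
  have := finite_obj k M
  have := finite_obj k N
  let f : (M ⟶ N) →ₗ[k] (M.obj →ₗ[k] N.obj) :=
    { toFun g := g.hom.hom.restrictScalars k
      map_add' _ _ := rfl
      map_smul' _ _ := rfl }
  exact Module.Finite.of_injective f fun g g' h => hom_ext_apply fun m => LinearMap.congr_fun h m

theorem isArtinian_obj (k : Type u) {A : Type u} [Field k] [Ring A] [Algebra k A]
    [Module.Finite k A] (M : FGModuleCat.{u} A) : IsArtinian A M.obj := by
  have := finite_obj k M
  exact isArtinian_of_tower k inferInstance

/-- An injective module whose socle embeds into a power of an injective module `W` is a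
summand of a power of `W`. -/
theorem isRetractOfSum_of_forall_simple (k : Type u) {A : Type u} [Field k] [Ring A]
    [Algebra k A] [Module.Finite k A] {I W : FGModuleCat.{u} A} [Injective I] [Injective W]
    (h : ∀ S : FGModuleCat.{u} A, IsSimpleModule A S.obj → (∃ f : S ⟶ I, f ≠ 0) →
      ∃ f : S ⟶ W, f ≠ 0) : IsRetractOfSum W I := by
  have := finite_hom k I W
  have := isArtinian_obj k I
  have := finite_obj k I
  have : IsNoetherian A I.obj := isNoetherian_of_tower k inferInstance
  let b := Module.finBasis k (I ⟶ W)
  refine isRetractOfSum_of_jointly_injective (fun j => b j) fun m hm => ?_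
  -- A simple submodule of the common kernel `K` would have a nonzero map to `W`. Its extension to
  -- `I` is a combination of the `b j`, all of which vanish on `K`: a contradiction.
  let K : Submodule A I.obj := ⨅ j, LinearMap.ker (b j).hom.hom
  have hK : K = ⊥ := by
    by_contra hne
    obtain ⟨S, hS, hSK⟩ := (eq_bot_or_exists_atom_le K).resolve_left hne
    have hS' : IsSimpleModule A S := isSimpleModule_iff_isAtom.2 hS
    let ι : FGModuleCat.of A S ⟶ I := homOf (M := FGModuleCat.of A S) S.subtype
    have : Mono ι := mono_of_injective _ Subtype.val_injective
    have := IsSimpleModule.nontrivial A S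
    obtain ⟨s, hs⟩ := exists_ne (0 : S)
    obtain ⟨f, hf⟩ := h (FGModuleCat.of A S) hS' ⟨ι, fun h0 => hs (Subtype.ext
      (congrArg (fun g : FGModuleCat.of A S ⟶ I => g.hom.hom s) h0))⟩
    refine hf ?_
    rw [← Injective.comp_factorThru f ι]
    refine eq_zero_of_apply_eq_zero fun x => ?_
    rw [comp_hom_apply, ← b.sum_repr (Injective.factorThru f ι), sum_apply']
    refine Finset.sum_eq_zero fun j _ => ?_
    rw [smul_apply']
    have : (b j).hom.hom (ι.hom.hom x) = 0 := (Submodule.mem_iInf _).1 (hSK x.2) j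
    rw [this, smul_zero]
  have : m ∈ K := (Submodule.mem_iInf _).2 hm
  rwa [hK, Submodule.mem_bot] at this

instance : Module.Finite A (AlgebraDual k A) := Module.Finite.of_restrictScalars_finite k A _

variable {k}

/-- Functionals on a module correspond to morphisms to `A^*`. -/
def toAlgebraDual {M : FGModuleCat.{u} A} (l : M.obj →ₗ[k] k) :
    M ⟶ FGModuleCat.of A (AlgebraDual k A) :=
  homOf (N := FGModuleCat.of A (AlgebraDual k A))
    { toFun m := show A →ₗ[k] k from l ∘ₗ (LinearMap.toSpanSingleton A M.obj m).restrictScalars k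
      map_add' m m' := by
        ext a
        change l (a • (m + m')) = l (a • m) + l (a • m')
        rw [smul_add, map_add]
      map_smul' b m := by
        ext a
        change l (a • b • m) = l ((a * b) • m)
        rw [smul_smul] }

end

end FGModuleCat

/-! ### Injective modules and the basic projective-injective module -/

namespace FGModuleCat

section

variable {k A : Type u} [Field k] [Ring A] [Algebra k A] [Module.Finite k A]

/-- The coefficient at `1` of a morphism to `A^*`. -/
def ofAlgebraDual {M : FGModuleCat.{u} A} (f : M ⟶ FGModuleCat.of A (AlgebraDual k A)) :
    M.obj →ₗ[k] k where
  toFun m := (show AlgebraDual k A from f.hom.hom m) 1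
  map_add' m m' := congrArg (AlgebraDual.evalOne k A) (map_add f.hom.hom m m')
  map_smul' c m := by
    have h : f.hom.hom (algebraMap k A c • m) = algebraMap k A c • f.hom.hom m := map_smul _ _ _
    refine (congrArg (AlgebraDual.evalOne k A) h).trans ?_
    refine (AlgebraDual.smul_apply_one _ _).trans ?_
    rw [Algebra.algebraMap_eq_smul_one, AlgebraDual.apply_smul]
    rfl

theorem toAlgebraDual_ofAlgebraDual {M : FGModuleCat.{u} A}
    (f : M ⟶ FGModuleCat.of A (AlgebraDual k A)) : toAlgebraDual (ofAlgebraDual f) = f :=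
  hom_ext_apply fun m => AlgebraDual.ext (k := k) (A := A) fun a =>
    (congrArg (AlgebraDual.evalOne k A) (map_smul f.hom.hom a m)).trans
      (AlgebraDual.smul_apply_one _ _)

/-- Morphisms `M ⟶ A^*` are the same as functionals on `M`, and functionals extend along injections.
-/
instance injective_algebraDual : Injective (FGModuleCat.of A (AlgebraDual k A)) where
  factors {M N} f i _ := by
    have hi : Function.Injective (i.hom.hom.restrictScalars k) := injective_of_mono i
    obtain ⟨l, hl⟩ := LinearMap.dualMap_surjective_of_injective hi (ofAlgebraDual f)
    refine ⟨toAlgebraDual l, ?_⟩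
    rw [← toAlgebraDual_ofAlgebraDual f, ← hl]
    refine hom_ext_apply fun m => AlgebraDual.ext (k := k) (A := A) fun a => ?_
    exact congrArg l (map_smul i.hom.hom a m).symm

variable (k) in
theorem isRetractOfSum_algebraDual (I : FGModuleCat.{u} A) [Injective I] :
    IsRetractOfSum (FGModuleCat.of A (AlgebraDual k A)) I := by
  have := finite_obj k I
  let b := Module.finBasis k I.obj
  refine isRetractOfSum_of_jointly_injective (fun j => toAlgebraDual (b.coord j)) fun m hm => ?_
  refine (Module.Basis.forall_coord_eq_zero_iff b).1 fun j => ?_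
  have h := congrArg (AlgebraDual.evalOne k A) (hm j)
  exact (congrArg (b.coord j) (one_smul A m)).symm.trans h

end

section

variable {A : Type u} [Ring A]

theorem isZero_of_id_eq_zero {M : FGModuleCat.{u} A} (h : 𝟙 M = 0) : IsZero M :=
  (IsZero.iff_id_eq_zero M).2 h

/-- This is the descent measure for splitting a module into indecomposables. -/
theorem finrank_lt_of_retract {k : Type u} [Field k] [Algebra k A]
    [Module.Finite k A] {M Y Z : FGModuleCat.{u} A} (i : Y ⟶ M) (r : M ⟶ Y) (h : i ≫ r = 𝟙 Y)
    (i' : Z ⟶ M) (r' : M ⟶ Z) (h' : i' ≫ r' = 𝟙 Z) (hi : i ≫ r' = 0) (hZ : ¬ IsZero Z) :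
    Module.finrank k Y.obj < Module.finrank k M.obj := by
  have := finite_obj k M
  have hinj : Function.Injective (i.hom.hom.restrictScalars k) := by
    refine Function.LeftInverse.injective (g := r.hom.hom) fun y => ?_
    exact congrArg (fun f : Y ⟶ Y => f.hom.hom y) h
  rw [← LinearMap.finrank_range_of_inj hinj]
  refine Submodule.finrank_lt fun htop => hZ (isZero_of_id_eq_zero ?_)
  have hr' : r' = 0 := eq_zero_of_apply_eq_zero fun m => by
    obtain ⟨y, rfl⟩ := (LinearMap.range_eq_top.1 htop) m
    exact congrArg (fun f : Y ⟶ Z => f.hom.hom y) hi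
  rw [← h', hr', comp_zero]

end

end FGModuleCat

namespace IsBasicProjInj

open FGModuleCat

variable {A : Type u} [Ring A] [IsNoetherianRing A] {Q : FGModuleCat.{u} A}

theorem projInj (hQ : IsBasicProjInj A Q) : projInj A Q := by
  obtain ⟨n, P, hP, -, -, ⟨e⟩⟩ := hQ
  let i (s : Fin n) : Q ⟶ P s := homOf (LinearMap.proj s ∘ₗ e.toLinearMap)
  let r (s : Fin n) : P s ⟶ Q :=
    homOf (e.symm.toLinearMap ∘ₗ LinearMap.single A (fun s => (P s).obj) s)
  have h : ∑ s, i s ≫ r s = 𝟙 Q := hom_ext_apply fun m => by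
    rw [sum_apply']
    change ∑ s, e.symm (Pi.single s (e m s)) = m
    rw [← map_sum, Finset.univ_sum_single, e.symm_apply_apply]
  exact ⟨IsRetractOfSum.projective_of_sum_eq_id (fun s => (hP s).2.1) i r h,
    IsRetractOfSum.injective_of_sum_eq_id (fun s => (hP s).2.2) i r h⟩

/-- Strong induction on dimension: an indecomposable module is isomorphic to one of the constituents
of `Q`, and any other nonzero module splits into two smaller projective-injective ones. -/
theorem isRetractOfSum (k : Type u) [Field k] [Algebra k A] [Module.Finite k A]
    (hQ : IsBasicProjInj A Q) (M : FGModuleCat.{u} A) (hM : _root_.projInj A M) :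
    IsRetractOfSum Q M := by
  induction hd : Module.finrank k M.obj using Nat.strong_induction_on generalizing M with
  | _ d ih =>
  subst hd
  by_cases hM0 : IsZero M
  · exact IsRetractOfSum.of_isZero hM0
  by_cases hind : Indecomposable M
  · obtain ⟨n, P, -, -, hP, ⟨e⟩⟩ := hQ
    obtain ⟨s, ⟨φ⟩⟩ := hP M hind hM
    refine IsRetractOfSum.of_retract
      (φ.hom ≫ homOf (e.symm.toLinearMap ∘ₗ LinearMap.single A (fun s => (P s).obj) s))
      (homOf (LinearMap.proj s ∘ₗ e.toLinearMap) ≫ φ.inv) ?_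
    refine hom_ext_apply fun m => ?_
    change φ.inv.hom.hom (e (e.symm (Pi.single s (φ.hom.hom.hom m))) s) = m
    rw [e.apply_symm_apply, Pi.single_eq_same]
    exact congrArg (fun f : M ⟶ M => f.hom.hom m) φ.hom_inv_id
  · have h : ¬ ∀ Y Z, (M ≅ Y ⊞ Z) → IsZero Y ∨ IsZero Z := fun h => hind ⟨hM0, h⟩
    simp only [not_forall, not_or] at h
    obtain ⟨Y, Z, φ, hY, hZ⟩ := h
    have hPI {X : FGModuleCat.{u} A} (i : X ⟶ M) (r : M ⟶ X) (h : i ≫ r = 𝟙 X) :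
        _root_.projInj A X :=
      have h' := IsRetractOfSum.of_retract i r h
      ⟨h'.projective hM.1, h'.injective hM.2⟩
    have h₁ : (biprod.inl ≫ φ.inv) ≫ φ.hom ≫ biprod.fst = 𝟙 Y := by simp
    have h₂ : (biprod.inr ≫ φ.inv) ≫ φ.hom ≫ biprod.snd = 𝟙 Z := by simp
    refine IsRetractOfSum.of_sum
      (ih _ (finrank_lt_of_retract _ _ h₁ _ _ h₂ (by simp) hZ) Y (hPI _ _ h₁) rfl)
      (ih _ (finrank_lt_of_retract _ _ h₂ _ _ h₁ (by simp) hY) Z (hPI _ _ h₂) rfl)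
      (φ.hom ≫ biprod.fst) (biprod.inl ≫ φ.inv) (φ.hom ≫ biprod.snd) (biprod.inr ≫ φ.inv) ?_
    have h : φ.hom ≫ (biprod.fst ≫ biprod.inl + biprod.snd ≫ biprod.inr) ≫ φ.inv = 𝟙 M := by
      rw [biprod.total, Category.id_comp, Iso.hom_inv_id]
    simpa only [Preadditive.add_comp, Preadditive.comp_add, Category.assoc] using h

end IsBasicProjInj

/-! ### The dual of a right module -/

section OpDual

variable (k : Type u) {A : Type u} [Field k] [Ring A] [Algebra k A]

section

variable (Y : Type u) [AddCommGroup Y] [Module k Y]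

/-- The `k`-dual of a right `A`-module, a left `A`-module through `(a • ψ) y = ψ (y * a)`. -/
def OpDual : Type u := Y →ₗ[k] k

instance : AddCommGroup (OpDual k Y) := inferInstanceAs (AddCommGroup (Y →ₗ[k] k))

instance : Module k (OpDual k Y) := inferInstanceAs (Module k (Y →ₗ[k] k))

variable {k Y}

namespace OpDual

instance : FunLike (OpDual k Y) Y k := inferInstanceAs (FunLike (Y →ₗ[k] k) Y k)

@[ext] theorem ext {φ ψ : OpDual k Y} (h : ∀ x, φ x = ψ x) : φ = ψ := LinearMap.ext h

theorem add_apply (φ ψ : OpDual k Y) (y : Y) : (φ + ψ) y = φ y + ψ y := rfl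

theorem zero_apply (y : Y) : (0 : OpDual k Y) y = 0 := rfl

theorem apply_add (φ : OpDual k Y) (x y : Y) : φ (x + y) = φ x + φ y :=
  LinearMap.map_add (show Y →ₗ[k] k from φ) x y

theorem apply_zero (φ : OpDual k Y) : φ 0 = 0 := LinearMap.map_zero (show Y →ₗ[k] k from φ)

theorem apply_smul (φ : OpDual k Y) (c : k) (x : Y) : φ (c • x) = c * φ x :=
  LinearMap.map_smul (show Y →ₗ[k] k from φ) c x

variable [Module Aᵐᵒᵖ Y] [IsScalarTower k Aᵐᵒᵖ Y]

instance : SMul A (OpDual k Y) where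
  smul a ψ := LinearMap.comp (show Y →ₗ[k] k from ψ) (Algebra.lsmul k k Y (MulOpposite.op a))

theorem smul_apply (a : A) (ψ : OpDual k Y) (y : Y) : (a • ψ) y = ψ (MulOpposite.op a • y) := rfl

instance : Module A (OpDual k Y) where
  one_smul ψ := by ext y; simp [smul_apply]
  mul_smul a b ψ := by ext y; simp [smul_apply, mul_smul]
  smul_zero a := by ext y; simp [smul_apply, zero_apply]
  smul_add a φ ψ := by ext y; simp [smul_apply, add_apply]
  add_smul a b ψ := by ext y; simp [smul_apply, add_apply, add_smul, apply_add]
  zero_smul ψ := by ext y; simp [smul_apply, zero_apply, apply_zero]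

instance : IsScalarTower k A (OpDual k Y) where
  smul_assoc c a ψ := by
    ext y
    change ψ (MulOpposite.op (c • a) • y) = c * ψ (MulOpposite.op a • y)
    rw [MulOpposite.op_smul, smul_assoc, apply_smul]

instance [Module.Finite k Y] [Module.Finite k A] : Module.Finite A (OpDual k Y) :=
  have : Module.Finite k (OpDual k Y) := inferInstanceAs (Module.Finite k (Module.Dual k Y))
  Module.Finite.of_restrictScalars_finite k A _

end OpDual

end

namespace FGModuleCat

variable [Module.Finite k A]

instance : Module.Finite k Aᵐᵒᵖ := Module.Finite.equiv (MulOpposite.opLinearEquiv k)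

/-- The left module which is the dual of a right module. -/
def opDual (Y : FGModuleCat.{u} Aᵐᵒᵖ) : FGModuleCat.{u} A :=
  haveI := finite_obj k Y
  FGModuleCat.of A (OpDual k Y.obj)

/-- The transpose of a morphism of right modules. -/
def opDualMap (Y Z : FGModuleCat.{u} Aᵐᵒᵖ) : (Y ⟶ Z) →+ (opDual k Z ⟶ opDual k Y) where
  toFun f := homOf (M := opDual k Z) (N := opDual k Y)
    { toFun (ψ : OpDual k Z.obj) := show OpDual k Y.obj from
        LinearMap.comp (show Z.obj →ₗ[k] k from ψ) (f.hom.hom.restrictScalars k)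
      map_add' _ _ := rfl
      map_smul' (a : A) (ψ : OpDual k Z.obj) := OpDual.ext fun y =>
        congrArg ψ (map_smul f.hom.hom (MulOpposite.op a) y).symm }
  map_zero' := hom_ext_apply fun (ψ : OpDual k Z.obj) => OpDual.ext fun _ => ψ.apply_zero
  map_add' f g := hom_ext_apply fun (ψ : OpDual k Z.obj) => OpDual.ext fun y =>
    ψ.apply_add (f.hom.hom y) (g.hom.hom y)

theorem opDualMap_id (Y : FGModuleCat.{u} Aᵐᵒᵖ) : opDualMap k Y Y (𝟙 Y) = 𝟙 (opDual k Y) := rfl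

theorem opDualMap_comp {X Y Z : FGModuleCat.{u} Aᵐᵒᵖ} (f : X ⟶ Y) (g : Y ⟶ Z) :
    opDualMap k X Z (f ≫ g) = opDualMap k Y Z g ≫ opDualMap k X Y f := rfl

theorem isRetractOfSum_opDual {K Y : FGModuleCat.{u} Aᵐᵒᵖ} (h : IsRetractOfSum K Y) :
    IsRetractOfSum (opDual k K) (opDual k Y) := by
  obtain ⟨ι, _, i, r, h⟩ := h
  refine ⟨ι, inferInstance, fun s => opDualMap k _ _ (r s), fun s => opDualMap k _ _ (i s), ?_⟩
  simp only [← opDualMap_comp]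
  rw [← map_sum, h, opDualMap_id]

theorem _root_.isNoetherianRing_of_finite (k : Type u) {A : Type u} [Field k] [Ring A]
    [Algebra k A] [Module.Finite k A] : IsNoetherianRing A := isNoetherian_of_tower k inferInstance

theorem opDual_projective_of_equiv {Y : FGModuleCat.{u} Aᵐᵒᵖ}
    (e : Y.obj ≃ₗ[Aᵐᵒᵖ] AlgebraDual k Aᵐᵒᵖ) : Projective (opDual k Y) := by
  let c : Y.obj ≃ₗ[k] AlgebraDual k Aᵐᵒᵖ := e.restrictScalars k
  let ev : A →ₗ[A] OpDual k Y.obj :=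
    { toFun a := LinearMap.comp (Module.Dual.eval k Aᵐᵒᵖ (MulOpposite.op a)) c.toLinearMap
      map_add' a b := OpDual.ext fun φ => (c φ).apply_add (MulOpposite.op a) (MulOpposite.op b)
      map_smul' a b := OpDual.ext fun φ => (congrArg (fun χ : AlgebraDual k Aᵐᵒᵖ =>
        χ (MulOpposite.op b)) (map_smul e (MulOpposite.op a) φ)).symm }
  have hev : Function.Bijective ev :=
    c.dualMap.bijective.comp
      ((Module.bijective_dual_eval k Aᵐᵒᵖ).comp MulOpposite.op_bijective)
  let e' := LinearEquiv.ofBijective ev hev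
  let i : regular A ⟶ opDual k Y := homOf (N := opDual k Y) e'.toLinearMap
  let r : opDual k Y ⟶ regular A := homOf (M := opDual k Y) e'.symm.toLinearMap
  have := isNoetherianRing_of_finite k (A := A)
  exact (IsRetractOfSum.of_retract r i
    (hom_ext_apply fun x => e'.apply_symm_apply x)).projective inferInstance

/-- An injective right module is a summand of a power of the dual of the regular one, and double
duality makes the dual of that the regular left module. -/
theorem opDual_projective {Y : FGModuleCat.{u} Aᵐᵒᵖ} [Injective Y] :
    Projective (opDual k Y) :=
  (isRetractOfSum_opDual k (isRetractOfSum_algebraDual k Y)).projective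
    (opDual_projective_of_equiv k (LinearEquiv.refl Aᵐᵒᵖ (AlgebraDual k Aᵐᵒᵖ)))

theorem opDual_injective_of_equiv {Y : FGModuleCat.{u} Aᵐᵒᵖ} (e : Aᵐᵒᵖ ≃ₗ[Aᵐᵒᵖ] Y.obj) :
    Injective (opDual k Y) := by
  let c : A ≃ₗ[k] Y.obj := MulOpposite.opLinearEquiv k ≪≫ₗ e.restrictScalars k
  have hc (a b : A) : c (a * b) = MulOpposite.op b • c a :=
    map_smul e (MulOpposite.op b) (MulOpposite.op a)
  let e' : OpDual k Y.obj ≃ₗ[A] AlgebraDual k A :=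
    { c.dualMap with
      map_smul' a ψ := AlgebraDual.ext fun b => (congrArg ψ (hc b a)).symm }
  let i : opDual k Y ⟶ FGModuleCat.of A (AlgebraDual k A) :=
    homOf (M := opDual k Y) (N := FGModuleCat.of A (AlgebraDual k A)) e'.toLinearMap
  let r : FGModuleCat.of A (AlgebraDual k A) ⟶ opDual k Y :=
    homOf (M := FGModuleCat.of A (AlgebraDual k A)) (N := opDual k Y) e'.symm.toLinearMap
  exact (IsRetractOfSum.of_retract i r
    (hom_ext_apply fun x => e'.symm_apply_apply x)).injective inferInstance

theorem opDual_injective {Y : FGModuleCat.{u} Aᵐᵒᵖ} [Projective Y] :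
    Injective (opDual k Y) := by
  obtain ⟨n, p, f, hp⟩ := exists_dualBasis Y
  let i (j : Fin n) : regular Aᵐᵒᵖ ⟶ Y := ofElement (p j)
  let r (j : Fin n) : Y ⟶ regular Aᵐᵒᵖ := homOf (f j)
  have h : IsRetractOfSum (regular Aᵐᵒᵖ) Y :=
    ⟨Fin n, inferInstance, r, i, hom_ext_apply fun y => (sum_apply' _ _ _).trans (hp y)⟩
  exact (isRetractOfSum_opDual k h).injective
    (opDual_injective_of_equiv k (LinearEquiv.refl Aᵐᵒᵖ Aᵐᵒᵖ))

end FGModuleCat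

end OpDual

/-! ### The double centraliser property and density -/

section Density

variable {k A : Type u} [Field k] [Ring A] [Algebra k A]

section

variable {Y : Type u} [AddCommGroup Y] [Module k Y] [Module Aᵐᵒᵖ Y] [IsScalarTower k Aᵐᵒᵖ Y]

namespace OpDual

/-- The morphism `Y^* → A^*` given by an element of the right module `Y`. -/
def evalHom (y : Y) : OpDual k Y →ₗ[A] AlgebraDual k A where
  toFun ψ := show A →ₗ[k] k from
    { toFun a := ψ (MulOpposite.op a • y)
      map_add' a b := by rw [MulOpposite.op_add, add_smul, apply_add]
      map_smul' c a := by
        rw [MulOpposite.op_smul, smul_assoc, apply_smul]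
        rfl }
  map_add' _ _ := rfl
  map_smul' a ψ := AlgebraDual.ext fun b => by
    change ψ (MulOpposite.op a • MulOpposite.op b • y) = ψ (MulOpposite.op (b * a) • y)
    rw [smul_smul, MulOpposite.op_mul]

theorem evalHom_apply (y : Y) (ψ : OpDual k Y) (a : A) :
    evalHom y ψ a = ψ (MulOpposite.op a • y) := rfl

theorem evalHom_add (y z : Y) : (evalHom (y + z) : OpDual k Y →ₗ[A] AlgebraDual k A) =
    evalHom y + evalHom z :=
  LinearMap.ext fun ψ => AlgebraDual.ext fun a => by
    rw [evalHom_apply, smul_add, apply_add]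
    rfl

theorem evalHom_injective :
    Function.Injective (evalHom : Y → (OpDual k Y →ₗ[A] AlgebraDual k A)) := fun y z h => by
  rw [← sub_eq_zero]
  refine (Module.forall_dual_apply_eq_zero_iff k (y - z)).1 fun ψ => ?_
  have h₁ : evalHom (A := A) y (show OpDual k Y from ψ) 1 =
      evalHom (A := A) z (show OpDual k Y from ψ) 1 := by rw [h]
  rw [evalHom_apply, evalHom_apply, MulOpposite.op_one, one_smul, one_smul] at h₁
  rw [map_sub, sub_eq_zero]
  exact h₁

/-- `Hom_A(Y^*, A^*)` is the double dual of `Y`: a morphism is determined by its values at `1`, and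
finite-dimensionality makes that functional an evaluation. -/
theorem evalHom_surjective [Module.Finite k Y] :
    Function.Surjective (evalHom : Y → (OpDual k Y →ₗ[A] AlgebraDual k A)) := fun v => by
  let l : Module.Dual k (Module.Dual k Y) :=
    { toFun ψ := v (show OpDual k Y from ψ) 1
      map_add' ψ χ := congrArg (AlgebraDual.evalOne k A) (map_add v (show OpDual k Y from ψ) χ)
      map_smul' c ψ := congrArg (AlgebraDual.evalOne k A)
        ((v.restrictScalars k).map_smul c (show OpDual k Y from ψ)) }
  obtain ⟨y, hy⟩ := (Module.bijective_dual_eval k Y).2 l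
  refine ⟨y, LinearMap.ext fun ψ => AlgebraDual.ext fun a => ?_⟩
  have h : (a • ψ) y = v (a • ψ) 1 := LinearMap.congr_fun hy (a • ψ)
  rw [map_smul, AlgebraDual.smul_apply_one] at h
  exact h

end OpDual

namespace AlgebraDual

/-- Right multiplication, as a morphism of left modules. -/
def rightMulHom (a : A) : AlgebraDual k A →ₗ[A] AlgebraDual k A where
  toFun φ := φ.rightMul a
  map_add' _ _ := rfl
  map_smul' b φ := smul_rightMul b φ a

theorem exists_rightMulHom [Module.Finite k A] (g : AlgebraDual k A →ₗ[A] AlgebraDual k A) :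
    ∃ a, g = rightMulHom a := by
  let l : Module.Dual k (Module.Dual k A) :=
    { toFun φ := g (show AlgebraDual k A from φ) 1
      map_add' φ χ := congrArg (evalOne k A) (map_add g (show AlgebraDual k A from φ) χ)
      map_smul' c φ := congrArg (evalOne k A)
        ((g.restrictScalars k).map_smul c (show AlgebraDual k A from φ)) }
  obtain ⟨a, ha⟩ := (Module.bijective_dual_eval k A).2 l
  refine ⟨a, LinearMap.ext fun φ => AlgebraDual.ext fun b => ?_⟩
  have h : (b • φ) a = g (b • φ) 1 := LinearMap.congr_fun ha (b • φ)
  rw [map_smul, smul_apply_one, smul_apply] at h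
  exact h.symm

end AlgebraDual

theorem OpDual.rightMulHom_comp_evalHom (a : A) (y : Y) :
    AlgebraDual.rightMulHom a ∘ₗ (evalHom y : OpDual k Y →ₗ[A] AlgebraDual k A) =
      evalHom (MulOpposite.op a • y) :=
  LinearMap.ext fun ψ => AlgebraDual.ext fun b => by
    change ψ (MulOpposite.op (a * b) • y) = ψ (MulOpposite.op b • MulOpposite.op a • y)
    rw [smul_smul, MulOpposite.op_mul]

/-- The transpose of an endomorphism of a right module. -/
def OpDual.transpose (f : Y →ₗ[Aᵐᵒᵖ] Y) : OpDual k Y →ₗ[A] OpDual k Y where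
  toFun ψ := LinearMap.comp (show Y →ₗ[k] k from ψ) (f.restrictScalars k)
  map_add' _ _ := rfl
  map_smul' a ψ := OpDual.ext fun y => congrArg ψ (map_smul f (MulOpposite.op a) y).symm

theorem OpDual.evalHom_comp_transpose (f : Y →ₗ[Aᵐᵒᵖ] Y) (y : Y) :
    (evalHom y : OpDual k Y →ₗ[A] AlgebraDual k A) ∘ₗ transpose f = evalHom (f y) :=
  LinearMap.ext fun ψ => AlgebraDual.ext fun b => congrArg ψ (map_smul f (MulOpposite.op b) y)

/-- Under `End(A^*) ≅ A` and `Hom(Y^*, A^*) ≅ Y`, composition becomes the action on `Y`, so the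
claim is that `Y` is faithful. -/
theorem HasDoubleCentraliser.ext [Module.Finite k A] (hY : HasDoubleCentraliser Aᵐᵒᵖ Y)
    {g g' : AlgebraDual k A →ₗ[A] AlgebraDual k A}
    (h : ∀ v : OpDual k Y →ₗ[A] AlgebraDual k A, g ∘ₗ v = g' ∘ₗ v) : g = g' := by
  obtain ⟨a, rfl⟩ := AlgebraDual.exists_rightMulHom g
  obtain ⟨b, rfl⟩ := AlgebraDual.exists_rightMulHom g'
  refine congrArg AlgebraDual.rightMulHom (MulOpposite.op_injective (hY.1 ?_))
  refine LinearMap.ext fun y => ?_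
  have h' := h (OpDual.evalHom y)
  rw [OpDual.rightMulHom_comp_evalHom, OpDual.rightMulHom_comp_evalHom] at h'
  exact OpDual.evalHom_injective h'

/-- Read on `Y`, the map `θ` commutes with all endomorphisms of `Y`, since these transpose to
endomorphisms of `Y^*`. The double centraliser property makes it the action of an element of the
algebra. -/
theorem HasDoubleCentraliser.exists_hom [Module.Finite k Y] (hY : HasDoubleCentraliser Aᵐᵒᵖ Y)
    (θ : (OpDual k Y →ₗ[A] AlgebraDual k A) →+ (OpDual k Y →ₗ[A] AlgebraDual k A))
    (hθ : ∀ (e : OpDual k Y →ₗ[A] OpDual k Y) (v : OpDual k Y →ₗ[A] AlgebraDual k A),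
      θ (v ∘ₗ e) = θ v ∘ₗ e) :
    ∃ g : AlgebraDual k A →ₗ[A] AlgebraDual k A, ∀ v, θ v = g ∘ₗ v := by
  choose T hT using fun y : Y => OpDual.evalHom_surjective (θ (OpDual.evalHom y))
  let T' : Module.End (Module.End Aᵐᵒᵖ Y) Y :=
    { toFun := T
      map_add' y z := OpDual.evalHom_injective (k := k) (A := A) (by
        rw [hT, OpDual.evalHom_add, OpDual.evalHom_add, map_add, hT, hT])
      map_smul' f y := OpDual.evalHom_injective (k := k) (A := A) (by
        change OpDual.evalHom (T (f y)) = OpDual.evalHom (f (T y))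
        rw [hT, ← OpDual.evalHom_comp_transpose f, ← OpDual.evalHom_comp_transpose f, hθ, hT]) }
  obtain ⟨a, ha⟩ := hY.2 T'
  refine ⟨AlgebraDual.rightMulHom a.unop, fun v => ?_⟩
  obtain ⟨y, rfl⟩ := OpDual.evalHom_surjective v
  rw [OpDual.rightMulHom_comp_evalHom, ← hT]
  exact congrArg OpDual.evalHom (LinearMap.congr_fun ha y).symm

end

variable [Module.Finite k A]

namespace FGModuleCat

theorem isDenseOn_opDual_algebraDual {Y : FGModuleCat.{u} Aᵐᵒᵖ}
    (hY : HasDoubleCentraliser Aᵐᵒᵖ Y) :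
    IsDenseOn (opDual k Y) (FGModuleCat.of A (AlgebraDual k A))
      (FGModuleCat.of A (AlgebraDual k A)) := by
  have := finite_obj k Y
  constructor
  · intro g g' h
    exact FGModuleCat.hom_ext (HasDoubleCentraliser.ext (k := k) hY
      (g := g.hom.hom) (g' := g'.hom.hom) fun v => congrArg (fun f : opDual k Y ⟶
        FGModuleCat.of A (AlgebraDual k A) => f.hom.hom) (h (homOf v)))
  · intro θ hθ
    let θ' : (OpDual k Y.obj →ₗ[A] AlgebraDual k A) →+ (OpDual k Y.obj →ₗ[A] AlgebraDual k A) :=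
      { toFun v := (θ (homOf v)).hom.hom
        map_zero' := congrArg (fun f : opDual k Y ⟶ FGModuleCat.of A (AlgebraDual k A) =>
          f.hom.hom) θ.map_zero
        map_add' v w := congrArg (fun f : opDual k Y ⟶ FGModuleCat.of A (AlgebraDual k A) =>
          f.hom.hom) (θ.map_add (homOf v) (homOf w)) }
    obtain ⟨g, hg⟩ := HasDoubleCentraliser.exists_hom (k := k) hY θ' fun e v =>
      congrArg (fun f : opDual k Y ⟶ FGModuleCat.of A (AlgebraDual k A) => f.hom.hom)
        (hθ (homOf e) (homOf v))
    exact ⟨homOf g, fun v => FGModuleCat.hom_ext (hg v.hom.hom)⟩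

/-- `V` is the dual of the given right module. Density holds on `A^*` and spreads to all injectives,
which are summands of its powers. -/
theorem exists_isDenseOn (k : Type u) {A : Type u} [Field k] [Ring A] [Algebra k A]
    [Module.Finite k A]
    (h : ∃ Y : FGModuleCat.{u} Aᵐᵒᵖ, projInj Aᵐᵒᵖ Y ∧ HasDoubleCentraliser Aᵐᵒᵖ Y) :
    ∃ V : FGModuleCat.{u} A, projInj A V ∧
      ∀ J J' : FGModuleCat.{u} A, Injective J → Injective J' → IsDenseOn V J J' := by
  obtain ⟨Y, ⟨hproj, hinj⟩, hY⟩ := h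
  exact ⟨opDual k Y, ⟨opDual_projective k, opDual_injective k⟩, fun J J' _ _ =>
    (isDenseOn_opDual_algebraDual hY).of_isRetractOfSum (isRetractOfSum_algebraDual k J)
      (isRetractOfSum_algebraDual k J')⟩

end FGModuleCat

end Density

/-! ### The Nakayama functor on projective-injective modules -/

section NakayamaProjInj

variable {k A : Type u} [Field k] [Ring A] [Algebra k A] [Module.Finite k A] [IsNoetherianRing A]

open FGModuleCat

theorem FGModuleCat.exists_ne_zero_iff_of_isGoodModule (k : Type u) {A : Type u} [Field k]
    [Ring A] [Algebra k A] [Module.Finite k A] {Q : FGModuleCat.{u} A}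
    (hgood : IsGoodModule A Q) {S : FGModuleCat.{u} A} (hS : IsSimpleModule A S.obj) :
    (∃ f : S ⟶ Q, f ≠ 0) ↔ ∃ f : Q ⟶ S, f ≠ 0 := by
  have := isArtinian_obj k Q
  rw [← exists_homOf_ne_zero_iff, ← exists_homOf_ne_zero_iff]
  exact hgood.exists_ne_zero_iff

/-- A simple in the socle of `HP` is in the head of `P`, so in the head of `Q`, so in its socle by
goodness. Hence `HP` is a summand of a power of the projective module `Q`. -/
theorem projInj_nakayamaFunctor_obj {Q : FGModuleCat.{u} A} (hQ : IsBasicProjInj A Q)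
    (hgood : IsGoodModule A Q) {P : FGModuleCat.{u} A} (hP : projInj A P) :
    projInj A ((nakayamaFunctor k A).obj P) := by
  have hP' : isProjective (FGModuleCat A) P := hP.1
  have hI := (nakayamaTrace k A).injective_obj hP'
  have := hQ.projInj.2
  refine ⟨(isRetractOfSum_of_forall_simple k fun S hS h => ?_).projective hQ.projInj.1, hI⟩
  obtain ⟨f, hf⟩ := ((nakayamaTrace k A).exists_ne_zero_iff hP').1 h
  exact (exists_ne_zero_iff_of_isGoodModule k hgood hS).2
    ((hQ.isRetractOfSum k P hP).exists_ne_zero_of_hom' hf)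

/-- The same comparison of simples in the other direction: the socle of `V` lies over that of `Q`,
hence over the head of `Q`, which controls the socle of `HQ`. -/
theorem isRetractOfSum_nakayamaFunctor_obj {Q : FGModuleCat.{u} A} (hQ : IsBasicProjInj A Q)
    (hgood : IsGoodModule A Q) {V : FGModuleCat.{u} A} (hV : projInj A V) :
    IsRetractOfSum ((nakayamaFunctor k A).obj Q) V := by
  have hQ' : isProjective (FGModuleCat A) Q := hQ.projInj.1
  have hI := (nakayamaTrace k A).injective_obj hQ'
  have := hV.2
  refine isRetractOfSum_of_forall_simple k fun S hS ⟨f, hf⟩ => ?_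
  exact ((nakayamaTrace k A).exists_ne_zero_iff hQ').2
    ((exists_ne_zero_iff_of_isGoodModule k hgood hS).1
      ((hQ.isRetractOfSum k V hV).exists_ne_zero_of_hom hf))

instance : ((isProjective (FGModuleCat.{u} A)).ι ⋙ nakayamaFunctor k A).Faithful where
  map_injective {X Y} _ _ h :=
    ObjectProperty.hom_ext _ ((nakayamaTrace k A).map_injective X.property Y.property h)

instance : ((isProjective (FGModuleCat.{u} A)).ι ⋙ nakayamaFunctor k A).Full where
  map_surjective {X Y} f := by
    have := finite_hom k X.obj Y.obj
    obtain ⟨g, hg⟩ := (nakayamaTrace k A).map_surjective X.property Y.property f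
    exact ⟨ObjectProperty.homMk g, hg⟩

/-- The given isomorphism is used only at `Q` and its endomorphisms. Density at `V` becomes density
at `HQ`, because `V` is a summand of a power of `HQ`. -/
theorem nonempty_iso_nakayamaFunctor {Q : FGModuleCat.{u} A} (hQ : IsBasicProjInj A Q)
    (hgood : IsGoodModule A Q)
    (hAop : ∃ X : FGModuleCat.{u} Aᵐᵒᵖ, projInj Aᵐᵒᵖ X ∧ HasDoubleCentraliser Aᵐᵒᵖ X)
    (F : FGModuleCat.{u} A ⥤ FGModuleCat.{u} A) [F.Additive]
    [((isProjective (FGModuleCat.{u} A)).ι ⋙ F).Full]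
    [((isProjective (FGModuleCat.{u} A)).ι ⋙ F).Faithful]
    (hF : ∀ P : FGModuleCat.{u} A, Projective P → Injective (F.obj P))
    (φ : (projInj A).ι ⋙ F ≅ (projInj A).ι ⋙ nakayamaFunctor k A) :
    Nonempty ((isProjective (FGModuleCat.{u} A)).ι ⋙ F ≅
      (isProjective (FGModuleCat.{u} A)).ι ⋙ nakayamaFunctor k A) := by
  obtain ⟨V, hV, hd⟩ := exists_isDenseOn k hAop
  have hQ' : isProjective (FGModuleCat A) Q := hQ.projInj.1
  have hI := (nakayamaTrace k A).injective_obj hQ'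
  refine nonempty_iso_of_isDenseOn _ _ (⟨Q, hQ'⟩ : (isProjective (FGModuleCat A)).FullSubcategory)
    (φ.app ⟨Q, hQ.projInj⟩) (fun x => φ.hom.naturality (X := ⟨Q, hQ.projInj⟩)
      (Y := ⟨Q, hQ.projInj⟩) (ObjectProperty.homMk x.hom)) (fun M => Injective M)
    (fun P => hF P.obj P.property) (fun P => (nakayamaTrace k A).injective_obj P.property)
    fun J J' hJ hJ' => ?_
  exact (hd J J' hJ hJ').of_isRetractOfSum_left (hd _ J' hI hJ')
    (isRetractOfSum_nakayamaFunctor_obj hQ hgood hV)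

end NakayamaProjInj

end

/-! ### The characterisation of Serre functors -/

theorem mainTheorem3 {k : Type u} [Field k] [IsAlgClosed k]
    {A : Type u} [Ring A] [Algebra k A] [Module.Finite k A] [IsNoetherianRing A]
    [HasDerivedCategory.{w} (FGModuleCat.{u} A)]
    (hgldim : HasFiniteGlobalDimension A)
    (Q : FGModuleCat.{u} A) (hQ : IsBasicProjInj A Q) (hgood : IsGoodModule A Q)
    (hA : ∃ X : FGModuleCat.{u} A, projInj A X ∧ HasDoubleCentraliser A X)
    (hAop : ∃ X : FGModuleCat.{u} Aᵐᵒᵖ, projInj Aᵐᵒᵖ X ∧ HasDoubleCentraliser Aᵐᵒᵖ X)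
    (F : FGModuleCat.{u} A ⥤ FGModuleCat.{u} A) [F.Additive] [PreservesFiniteColimits F] :
    (∃ LF : DerivedCategory.Bounded (FGModuleCat.{u} A) ⥤
        DerivedCategory.Bounded (FGModuleCat.{u} A), IsBoundedLeftDerived F LF) ∧
    ∀ LF : DerivedCategory.Bounded (FGModuleCat.{u} A) ⥤
        DerivedCategory.Bounded (FGModuleCat.{u} A), IsBoundedLeftDerived F LF →
      (IsSerreFunctor k LF ↔
        LF.IsEquivalence ∧
        (∀ P : FGModuleCat.{u} A, Projective P → Injective (F.obj P)) ∧
        ((∀ M : FGModuleCat.{u} A, projInj A M → projInj A (F.obj M)) ∧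
          Nonempty ((projInj A).ι ⋙ F ≅ (projInj A).ι ⋙ nakayamaFunctor k A))) := by
  obtain ⟨d, hd⟩ := hgldim
  have hC : ∀ M : FGModuleCat.{u} A, ∃ n, HasProjectiveDimensionLE M n := fun M => ⟨d, hd M⟩
  refine ⟨⟨_, isBoundedLeftDerived_projectiveResolutionFunctor hC F⟩, fun LF h => ⟨?_, ?_⟩⟩
  · rintro ⟨-, ⟨D⟩, hLF⟩
    -- From here (b) and (c) are properties of `H`, transported along the isomorphism on
    -- projectives.
    obtain ⟨e⟩ := h.nonempty_iso_of_serreDuality hC D (nakayamaTrace k A)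
    have hP (P : FGModuleCat.{u} A) (hP : Projective P) :
        F.obj P ≅ (nakayamaFunctor k A).obj P := e.app ⟨P, hP⟩
    refine ⟨hLF, fun P hproj => ?_, fun M hM => ?_, ⟨NatIso.ofComponents
      (fun M => e.app ⟨M.obj, M.property.1⟩) fun {M N} f => e.hom.naturality
        (X := ⟨M.obj, M.property.1⟩) (Y := ⟨N.obj, N.property.1⟩) (ObjectProperty.homMk f.hom)⟩⟩
    · exact Injective.of_iso (hP P hproj).symm ((nakayamaTrace k A).injective_obj hproj)
    · have hM' := projInj_nakayamaFunctor_obj (k := k) hQ hgood hM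
      exact ⟨Projective.of_iso (hP M hM.1).symm hM'.1, Injective.of_iso (hP M hM.1).symm hM'.2⟩
  · rintro ⟨hLF, hF, -, ⟨φ⟩⟩
    obtain ⟨_, _⟩ := h.isFullyFaithful hC
    obtain ⟨e⟩ := nonempty_iso_nakayamaFunctor hQ hgood hAop F hF φ
    -- The trace of `H` is carried to `F` and then derived; the equivalence itself is condition (a).
    obtain ⟨t⟩ := h.nonempty_serreTrace hC ((nakayamaTrace k A).ofIso e)
    exact ⟨h.additive hC, ⟨t.toSerreDuality fun _ => trivial⟩, hLF⟩
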